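/- Let $X=(X_t)_{t\ge 0}$ be a real-valued Lévy process, $X_0=0$ a.s., with $$E\,e^{izX_t}=e^{-t\lambda(z)},\qquad \lambda(z)=\tfrac12Az^2-i\gamma z-\int_{-\infty}^{\infty}\bigl(e^{ixz}-1-ixz\,1_{\{|x|\le1\}}\bigr)\,\nu'(x)\,dx,$$ where $A\ge0$ and $\gamma\in\mathbb R$. The real function $\nu$ is assumed to be nondecreasing on $(-\infty,0)$ and on $(0,\infty)$ and differentiable at every $x\neq0$, with $\int_{-\infty}^{\infty}\frac{x^2}{1+x^2}\nu'(x)\,dx<\infty$ and $\nu(x)\to0$ as $x\to\pm\infty$. Assume moreover that one of the following holds: (a) for every $M>0$, $\int_{-M}^M|\nu(x)|\,dx<\infty$ and $\int_{-M}^M|x|\,\nu'(x)\,dx<\infty$; and $x\nu(x)\to0$ as $x\to0$; (b) there is a function $\kappa$ with $\kappa'(x)=\nu(x)$ for all $x\ne0$ such that for every $M>0$, $\int_{-M}^M|\kappa(x)|\,dx<\infty$ and $\int_{-M}^M|x\nu(x)|\,dx<\infty$; and $x\kappa(x)\to0$, $x^2\nu(x)\to0$ as $x\to0$. Let $P_tf(x)=E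 f(x+X_t)$, and let $L$ be the infinitesimal generator of the semigroup $(P_t)$ on the space $C_0(\mathbb R)$ of real continuous functions vanishing at infinity with the supremum norm, i.e. $Lf=\lim_{t\downarrow0}(P_tf-f)/t$ in this norm, on the domain of all $f\in C_0(\mathbb R)$ for which the limit exists. Then there is a locally integrable function $k:\mathbb R\to\mathbb R$, with $k'(x)=\nu(x)$ for all $x\ne0$, such that every twice continuously differentiable $f$ with compact support belongs to the domain of $L$ and $$Lf=\frac{d}{dx}\,S\,\frac{d}{dx}f,\qquad Sg(x)=\frac A2\,g(x)+\int_{-\infty}^{\infty}k(y-x)\,g(y)\,dy,$$ where for $g=f'$ the integral converges absolutely for every $x$, $Sf'$ is differentiable at every $x$, and the identity holds at every $x\in\mathbb R$. -/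

import Mathlib

open MeasureTheory ProbabilityTheory Filter Topology Set
open scoped NNReal ENNReal ZeroAtInfty

noncomputable section

/-- A real-valued Lévy process indexed by `[0, ∞)`: it starts at `0` almost surely, has independent
and stationary increments, is stochastically continuous, and almost surely has right-continuous
paths with left limits. -/
structure IsLevyProcess {Ω : Type*} [MeasurableSpace Ω] (X : ℝ≥0 → Ω → ℝ) (P : Measure Ω) :
    Prop where
  measurable : ∀ t, Measurable (X t)
  start : ∀ᵐ ω ∂P, X 0 ω = 0
  indep : HasIndepIncrements X P
  stationary : ∀ s t : ℝ≥0, IdentDistrib (fun ω => X (s + t) ω - X s ω) (X t) P P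
  stochCont : ∀ t : ℝ≥0, TendstoInMeasure P X (𝓝 t) (X t)
  cadlag : ∀ᵐ ω ∂P, ∀ t : ℝ≥0, ContinuousWithinAt (fun s => X s ω) (Ici t) t ∧
    ∃ l : ℝ, Tendsto (fun s => X s ω) (𝓝[<] t) (𝓝 l)

/-- The exponent
`λ(z) = A z² / 2 - i γ z - ∫ (e^{i x z} - 1 - i x z 1_{|x| ≤ 1}) dN(x)`
of the Lévy-Khinchine formula, for the triplet `(A, γ, N)`. -/
def levyExponent (A γ : ℝ) (N : Measure ℝ) (z : ℝ) : ℂ :=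
  (A / 2 * z ^ 2 : ℝ) - Complex.I * γ * z -
    ∫ x : ℝ, (Complex.exp (Complex.I * x * z) - 1 -
      (Icc (-1 : ℝ) 1).indicator (fun u : ℝ => Complex.I * u * z) x) ∂N

/-- The process `X` has the Lévy-Khinchine triplet `(A, γ, N)`: `E e^{i z X_t} = e^{-t λ(z)}`. -/
def HasLevyTriplet {Ω : Type*} [MeasurableSpace Ω] (X : ℝ≥0 → Ω → ℝ) (P : Measure Ω)
    (A γ : ℝ) (N : Measure ℝ) : Prop :=
  ∀ (t : ℝ≥0) (z : ℝ),
    charFun (P.map (X t)) z = Complex.exp (-((t : ℝ) : ℂ) * levyExponent A γ N z)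

/-- The measure `dν = ν'(x) dx`. (The value at `x = 0` does not matter.) -/
def levyMeasure (ν : ℝ → ℝ) : Measure ℝ :=
  volume.withDensity fun x => ENNReal.ofReal (deriv ν x)

/-- The transition probability `P_t(x, ·)`: the law at time `t` of the process started at `x`. -/
def transitionProb {Ω : Type*} [MeasurableSpace Ω] (X : ℝ≥0 → Ω → ℝ) (P : Measure Ω)
    (t : ℝ≥0) (x : ℝ) : Measure ℝ :=
  P.map fun ω => x + X t ω

/-- The transition operator `P_t f(x) = ∫ P_t(x, dy) f(y)`. -/
def transitionOp {Ω : Type*} [MeasurableSpace Ω] (X : ℝ≥0 → Ω → ℝ) (P : Measure Ω)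
    (t : ℝ≥0) (f : ℝ → ℝ) (x : ℝ) : ℝ :=
  ∫ y, f y ∂(transitionProb X P t x)

/-- The infinitesimal generator of `X` on the Banach space `C₀(ℝ)`: `IsGeneratorValue X P f g` says
that `f` lies in the domain of the generator `L` and that `L f = g`, i.e. that
`(P_t f - f) / t → g` in the sup norm as `t ↓ 0`. -/
def IsGeneratorValue {Ω : Type*} [MeasurableSpace Ω] (X : ℝ≥0 → Ω → ℝ) (P : Measure Ω)
    (f g : C₀(ℝ, ℝ)) : Prop :=
  TendstoUniformly (fun (t : ℝ≥0) (x : ℝ) => (transitionOp X P t f x - f x) / (t : ℝ)) g (𝓝[>] 0)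

/-- The value of the generator is unique. -/
theorem IsGeneratorValue.unique {Ω : Type*} [MeasurableSpace Ω] {X : ℝ≥0 → Ω → ℝ} {P : Measure Ω}
    {f g h : C₀(ℝ, ℝ)} (hg : IsGeneratorValue X P f g) (hh : IsGeneratorValue X P f h) :
    g = h :=
  ZeroAtInftyContinuousMap.ext fun x =>
    tendsto_nhds_unique (hg.tendsto_at x) (hh.tendsto_at x)

/-- `ν` increases on each of the two half-lines, is differentiable off `0`, vanishes at `±∞`, and
`ν'(x) dx` is a Lévy measure. -/
structure IsLevyFunction (ν : ℝ → ℝ) : Prop where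
  mono_neg : MonotoneOn ν (Iio 0)
  mono_pos : MonotoneOn ν (Ioi 0)
  diff : ∀ x, x ≠ 0 → DifferentiableAt ℝ ν x
  levy : Integrable fun x => x ^ 2 / (1 + x ^ 2) * deriv ν x
  tendsto_atBot : Tendsto ν atBot (𝓝 0)
  tendsto_atTop : Tendsto ν atTop (𝓝 0)

/-- First set of conditions: `ν` and `|x| ν'` are locally integrable and `x ν(x) → 0` at `0`. -/
structure FirstCondition (ν : ℝ → ℝ) : Prop where
  isLevy : IsLevyFunction ν
  int_ν : ∀ M : ℝ, 0 < M → IntegrableOn ν (Icc (-M) M)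
  int_deriv : ∀ M : ℝ, 0 < M → IntegrableOn (fun x => |x| * deriv ν x) (Icc (-M) M)
  lim : Tendsto (fun x => x * ν x) (𝓝[≠] 0) (𝓝 0)

/-- Second set of conditions: some primitive `k` of `ν` off `0` is locally integrable, as is
`x ν(x)`, and `x k(x) → 0`, `x² ν(x) → 0` at `0`. -/
structure SecondCondition (ν : ℝ → ℝ) : Prop where
  isLevy : IsLevyFunction ν
  int_ν : ∀ M : ℝ, 0 < M → IntegrableOn (fun x => x * ν x) (Icc (-M) M)
  lim_ν : Tendsto (fun x => x ^ 2 * ν x) (𝓝[≠] 0) (𝓝 0)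
  prim : ∃ k : ℝ → ℝ, (∀ x, x ≠ 0 → HasDerivAt k (ν x) x) ∧
    (∀ M : ℝ, 0 < M → IntegrableOn k (Icc (-M) M)) ∧
    Tendsto (fun x => x * k x) (𝓝[≠] 0) (𝓝 0)

/-- The operator `S f(x) = (A / 2) f(x) + ∫ k(y - x) f(y) dy`. -/
def convOp (A : ℝ) (k f : ℝ → ℝ) (x : ℝ) : ℝ :=
  A / 2 * f x + ∫ y, k (y - x) * f y

end

/-!
Let `N` be the Lévy measure, `λ` the exponent, and

  `G f(x) = (A / 2) f''(x) + γ f'(x) + ∫ (f(x + y) - f(x) - y f'(x) 1_{|y| ≤ 1}) dN(y)`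

(`levyOperator`). The proof identifies the generator with `G` on compactly supported `C²` functions,
and then writes `G` as `d/dx S d/dx`.

*The generator.* A smooth compactly supported `f` is a Fourier integral `∫ h(z) e^{ixz} dz` with
`(1 + z²) h(z)` integrable. Applying `P_t` multiplies `h` by `e^{-tλ}`, while `G` multiplies it by
`-λ` (`IsFourierDensity.levyOperator_eq`), and `λ` grows at most quadratically. Since
`|e^{-tλ}| ≤ 1`, dominated convergence in the variable `z` gives `(P_t f - f) / t → G f` uniformly
(`IsFourierDensity.tendstoUniformly`). Moreover `P_t f - f = ∫₀ᵗ P_s G f ds`, so that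
`‖P_t f - f‖ ≤ t ‖G f‖` (`IsFourierDensity.abs_integral_sub_le`). As `‖G f‖` is controlled by the
`C²` norm of `f` (`abs_levyOperator_le`), this bound makes the difference quotients
equicontinuous in the `C²` norm, and mollification extends the convergence to all compactly
supported `C²` functions (`HasCompactSupport.tendstoUniformly_levyOperator`).

*The factorization.* The first set of conditions implies the second, with `κ(x) = ∫₀ˣ ν`
(`FirstCondition.secondCondition`). Under the second, integrating by parts twice on each half-line
turns the jump part of `G f(x)` into `∫ κ(y) f''(x + y) dy` plus a multiple of `f'(x)`
(`integral_compensatedIncrement_mul_deriv`). Adding a constant `C` to `κ` on `(0, ∞)` changes the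
integral by `-C f'(x)`, so a suitable `C` absorbs this multiple and the drift `γ f'`. The
resulting `k` is locally integrable, and differentiating the convolution of `f'` with `k` under
the integral sign gives `G f` (`hasDerivAt_convOp`).
-/

/-! ### The integro-differential form of the generator -/

/-- The increment of `φ` over a jump of size `y` from `x`, with the first-order term subtracted
for small jumps `|y| ≤ 1`. -/
noncomputable def compensatedIncrement {E : Type*} [NormedAddCommGroup E] [NormedSpace ℝ E]
    (φ : ℝ → E) (x y : ℝ) : E :=
  φ (x + y) - φ x - (Icc (-1 : ℝ) 1).indicator (fun u : ℝ => u • deriv φ x) y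

/-- The operator `(A / 2) f'' + γ f' + ∫ (f(x + y) - f(x) - y f'(x) 1_{|y| ≤ 1}) dN(y)`, to which
the generator of a Lévy process with triplet `(A, γ, N)` reduces on smooth functions. -/
noncomputable def levyOperator (A γ : ℝ) (N : Measure ℝ) (f : ℝ → ℝ) (x : ℝ) : ℝ :=
  A / 2 * deriv (deriv f) x + γ * deriv f x + ∫ y, compensatedIncrement f x y ∂N

section Taylor

variable {E : Type*} [NormedAddCommGroup E] [NormedSpace ℝ E]

theorem ContDiff.deriv_of_two {φ : ℝ → E} (hφ : ContDiff ℝ 2 φ) : ContDiff ℝ 1 (deriv φ) := by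
  have : ContDiff ℝ (1 + 1) φ := by simpa [one_add_one_eq_two] using hφ
  exact (contDiff_succ_iff_deriv.1 this).2.2

/-- Taylor's bound with the constant `b` in place of the sharp `b / 2`, which costs only two
applications of the mean value inequality. -/
theorem norm_taylor_one_le {φ : ℝ → E} (hφ : ContDiff ℝ 2 φ) {b : ℝ}
    (hb : ∀ x, ‖deriv (deriv φ) x‖ ≤ b) (x y : ℝ) :
    ‖φ (x + y) - φ x - y • deriv φ x‖ ≤ b * y ^ 2 := by
  have hb0 : 0 ≤ b := (norm_nonneg _).trans (hb 0)
  have hφ' := hφ.deriv_of_two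
  have h1 : ∀ u v, ‖deriv φ v - deriv φ u‖ ≤ b * ‖v - u‖ := fun u v =>
    convex_univ.norm_image_sub_le_of_norm_deriv_le
      (fun z _ => hφ'.differentiable one_ne_zero z) (fun z _ => hb z) (mem_univ _) (mem_univ _)
  have h2 : ∀ s, HasDerivAt (fun s => φ (x + s) - s • deriv φ x)
      (deriv φ (x + s) - deriv φ x) s := fun s => by
    have e1 : HasDerivAt (fun s => φ (x + s)) (deriv φ (x + s)) s :=
      ((hφ.differentiable two_ne_zero (x + s)).hasDerivAt).comp_const_add x s
    simpa using e1.fun_sub ((hasDerivAt_id s).smul_const (deriv φ x))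
  have h3 := (convex_uIcc (0 : ℝ) y).norm_image_sub_le_of_norm_hasDerivWithin_le
    (f := fun s => φ (x + s) - s • deriv φ x) (C := b * |y|)
    (fun s _ => (h2 s).hasDerivWithinAt)
    (fun s hs => by
      refine (h1 x (x + s)).trans ?_
      have : |s| ≤ |y| := by simpa using abs_sub_left_of_mem_uIcc hs
      simpa using mul_le_mul_of_nonneg_left this hb0)
    left_mem_uIcc right_mem_uIcc
  have h4 : b * |y| * ‖y - 0‖ = b * y ^ 2 := by
    rw [sub_zero, Real.norm_eq_abs, mul_assoc, ← abs_mul, ← sq, abs_of_nonneg (sq_nonneg y)]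
  rw [h4] at h3
  convert h3 using 2
  simp
  abel

/-- The weight `y² / (1 + y²)` is at least `y² / 2` for `|y| ≤ 1`, where Taylor's bound applies, and
at least `1 / 2` for `|y| > 1`, where the increment is at most `2 a`. -/
theorem norm_compensatedIncrement_le {φ : ℝ → E} (hφ : ContDiff ℝ 2 φ) {a b : ℝ}
    (ha : ∀ x, ‖φ x‖ ≤ a) (hb : ∀ x, ‖deriv (deriv φ) x‖ ≤ b) (x y : ℝ) :
    ‖compensatedIncrement φ x y‖ ≤ (4 * a + 2 * b) * (y ^ 2 / (1 + y ^ 2)) := by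
  have ha0 : 0 ≤ a := (norm_nonneg _).trans (ha 0)
  have hb0 : 0 ≤ b := (norm_nonneg _).trans (hb 0)
  have hy : 0 < 1 + y ^ 2 := by positivity
  rw [← mul_div_assoc, le_div_iff₀ hy]
  unfold compensatedIncrement
  by_cases h : y ∈ Icc (-1 : ℝ) 1
  · rw [indicator_of_mem h]
    have h1 : y ^ 2 ≤ 1 := by rw [sq_le_one_iff_abs_le_one]; exact abs_le.2 h
    calc _ ≤ b * y ^ 2 * 2 := by
          gcongr
          · exact norm_taylor_one_le hφ hb x y
          · linarith
      _ ≤ _ := by nlinarith [mul_nonneg ha0 (sq_nonneg y)]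
  · rw [indicator_of_notMem h, sub_zero]
    have h1 : 1 ≤ y ^ 2 := by
      rw [one_le_sq_iff_one_le_abs]
      by_contra! h'
      exact h (abs_le.1 h'.le)
    calc _ ≤ (a + a) * (1 + y ^ 2) := by
          gcongr
          exact (norm_sub_le _ _).trans (add_le_add (ha _) (ha _))
      _ ≤ _ := by nlinarith [mul_nonneg hb0 (sq_nonneg y), mul_nonneg ha0 (sub_nonneg.2 h1)]

theorem continuous_compensatedIncrement_left {φ : ℝ → E} (hφ : ContDiff ℝ 2 φ) (y : ℝ) :
    Continuous fun x => compensatedIncrement φ x y := by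
  have h1 := hφ.continuous
  have h2 := hφ.continuous_deriv one_le_two
  unfold compensatedIncrement
  by_cases h : y ∈ Icc (-1 : ℝ) 1
  · simp only [indicator_of_mem h]; fun_prop
  · simp only [indicator_of_notMem h]; fun_prop

theorem stronglyMeasurable_compensatedIncrement {φ : ℝ → E} (hφ : ContDiff ℝ 2 φ) (x : ℝ) :
    StronglyMeasurable (compensatedIncrement φ x) := by
  have h1 := hφ.continuous
  have h2 : Continuous fun y => φ (x + y) - φ x := by fun_prop
  have h3 : Continuous fun u : ℝ => u • deriv φ x := by fun_prop
  exact h2.stronglyMeasurable.sub (h3.stronglyMeasurable.indicator measurableSet_Icc)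

theorem compensatedIncrement_sub {φ ψ : ℝ → E} (hφ : ContDiff ℝ 2 φ) (hψ : ContDiff ℝ 2 ψ)
    (x y : ℝ) : compensatedIncrement (φ - ψ) x y =
      compensatedIncrement φ x y - compensatedIncrement ψ x y := by
  have : deriv (φ - ψ) x = deriv φ x - deriv ψ x :=
    deriv_sub (hφ.differentiable two_ne_zero x) (hψ.differentiable two_ne_zero x)
  unfold compensatedIncrement
  by_cases h : y ∈ Icc (-1 : ℝ) 1
  · simp only [indicator_of_mem h, this, smul_sub, Pi.sub_apply]; abel
  · simp only [indicator_of_notMem h, Pi.sub_apply]; abel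

theorem ContDiff.continuous_deriv_deriv {φ : ℝ → E} (hφ : ContDiff ℝ 2 φ) :
    Continuous (deriv (deriv φ)) :=
  hφ.deriv_of_two.continuous_deriv le_rfl

theorem HasCompactSupport.exists_norm_compensatedIncrement_le {φ : ℝ → E}
    (hφ : ContDiff ℝ 2 φ) (hc : HasCompactSupport φ) :
    ∃ C, ∀ x y, ‖compensatedIncrement φ x y‖ ≤ C * (y ^ 2 / (1 + y ^ 2)) := by
  obtain ⟨a, ha⟩ := hc.exists_bound_of_continuous hφ.continuous
  obtain ⟨b, hb⟩ := hc.deriv.deriv.exists_bound_of_continuous hφ.continuous_deriv_deriv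
  exact ⟨_, norm_compensatedIncrement_le hφ ha hb⟩

end Taylor

section LevyOperator

variable {A γ : ℝ} {N : Measure ℝ} {f g : ℝ → ℝ}

theorem integrable_compensatedIncrement (hN : Integrable (fun y : ℝ => y ^ 2 / (1 + y ^ 2)) N)
    (hf : ContDiff ℝ 2 f) (hc : HasCompactSupport f) (x : ℝ) :
    Integrable (compensatedIncrement f x) N := by
  obtain ⟨C, hC⟩ := hc.exists_norm_compensatedIncrement_le hf
  exact (hN.const_mul C).mono' (stronglyMeasurable_compensatedIncrement hf x).aestronglyMeasurable
    (.of_forall (hC x))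

theorem levyOperator_sub (hN : Integrable (fun y : ℝ => y ^ 2 / (1 + y ^ 2)) N)
    (hf : ContDiff ℝ 2 f) (hfc : HasCompactSupport f)
    (hg : ContDiff ℝ 2 g) (hgc : HasCompactSupport g) (x : ℝ) :
    levyOperator A γ N (f - g) x = levyOperator A γ N f x - levyOperator A γ N g x := by
  have h1 : deriv (f - g) = deriv f - deriv g := funext fun x =>
    deriv_sub (hf.differentiable two_ne_zero x) (hg.differentiable two_ne_zero x)
  have h2 : deriv (deriv f - deriv g) x = deriv (deriv f) x - deriv (deriv g) x :=
    deriv_sub (hf.deriv_of_two.differentiable one_ne_zero x)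
      (hg.deriv_of_two.differentiable one_ne_zero x)
  unfold levyOperator
  simp only [compensatedIncrement_sub hf hg]
  rw [integral_sub (integrable_compensatedIncrement hN hf hfc x)
    (integrable_compensatedIncrement hN hg hgc x), h1, h2, Pi.sub_apply]
  ring

theorem abs_levyOperator_le (hN : Integrable (fun y : ℝ => y ^ 2 / (1 + y ^ 2)) N)
    (hf : ContDiff ℝ 2 f) {δ : ℝ} (h0 : ∀ x, ‖f x‖ ≤ δ) (h1 : ∀ x, ‖deriv f x‖ ≤ δ)
    (h2 : ∀ x, ‖deriv (deriv f) x‖ ≤ δ) (x : ℝ) :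
    |levyOperator A γ N f x| ≤ (|A / 2| + |γ| + 6 * ∫ y, y ^ 2 / (1 + y ^ 2) ∂N) * δ := by
  have h3 : ‖∫ y, compensatedIncrement f x y ∂N‖ ≤ ∫ y, 6 * δ * (y ^ 2 / (1 + y ^ 2)) ∂N :=
    norm_integral_le_of_norm_le (hN.const_mul _) (.of_forall fun y =>
      (norm_compensatedIncrement_le hf h0 h2 x y).trans_eq (by ring))
  rw [integral_const_mul] at h3
  have h4 : |A / 2 * deriv (deriv f) x| ≤ |A / 2| * δ := by
    rw [abs_mul]; exact mul_le_mul_of_nonneg_left (h2 x) (abs_nonneg _)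
  have h5 : |γ * deriv f x| ≤ |γ| * δ := by
    rw [abs_mul]; exact mul_le_mul_of_nonneg_left (h1 x) (abs_nonneg _)
  calc _ ≤ |A / 2 * deriv (deriv f) x| + |γ * deriv f x| + ‖∫ y, compensatedIncrement f x y ∂N‖ :=
        abs_add_three _ _ _
    _ ≤ _ := by linarith

theorem continuous_levyOperator (hN : Integrable (fun y : ℝ => y ^ 2 / (1 + y ^ 2)) N)
    (hf : ContDiff ℝ 2 f) (hc : HasCompactSupport f) : Continuous (levyOperator A γ N f) := by
  obtain ⟨C, hC⟩ := hc.exists_norm_compensatedIncrement_le hf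
  have h1 := hf.continuous_deriv_deriv
  have h2 := hf.deriv_of_two.continuous
  have h3 : Continuous fun x => ∫ y, compensatedIncrement f x y ∂N :=
    continuous_of_dominated
      (fun x => (stronglyMeasurable_compensatedIncrement hf x).aestronglyMeasurable)
      (fun x => .of_forall (hC x)) (hN.const_mul C)
      (.of_forall (continuous_compensatedIncrement_left hf))
  unfold levyOperator
  fun_prop

theorem tendsto_levyOperator_cocompact
    (hN : Integrable (fun y : ℝ => y ^ 2 / (1 + y ^ 2)) N)
    (hf : ContDiff ℝ 2 f) (hc : HasCompactSupport f) :
    Tendsto (levyOperator A γ N f) (cocompact ℝ) (𝓝 0) := by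
  obtain ⟨C, hC⟩ := hc.exists_norm_compensatedIncrement_le hf
  have h0 {g : ℝ → ℝ} (hg : HasCompactSupport g) : Tendsto g (cocompact ℝ) (𝓝 0) :=
    hg.is_zero_at_infty
  have h1 : Tendsto (fun x => ∫ y, compensatedIncrement f x y ∂N) (cocompact ℝ)
      (𝓝 (∫ _, 0 ∂N)) := by
    have : (cocompact ℝ).IsCountablyGenerated := by
      rw [cocompact_eq_atBot_atTop]; infer_instance
    refine tendsto_integral_filter_of_dominated_convergence
      (fun y => C * (y ^ 2 / (1 + y ^ 2)))
      (.of_forall fun x => (stronglyMeasurable_compensatedIncrement hf x).aestronglyMeasurable)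
      (.of_forall fun x => .of_forall (hC x)) (hN.const_mul C) (.of_forall fun y => ?_)
    have e1 : Tendsto (fun x => f (x + y)) (cocompact ℝ) (𝓝 0) :=
      (h0 hc).comp (Homeomorph.addRight y).isClosedEmbedding.tendsto_cocompact
    have e2 := h0 hc
    have e3 := h0 hc.deriv
    unfold compensatedIncrement
    by_cases h : y ∈ Icc (-1 : ℝ) 1
    · simp only [indicator_of_mem h]; simpa using (e1.sub e2).sub (e3.const_smul y)
    · simp only [indicator_of_notMem h]; simpa using (e1.sub e2)
  unfold levyOperator
  simpa using (((h0 hc.deriv.deriv).const_mul (A / 2)).add ((h0 hc.deriv).const_mul γ)).add h1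

end LevyOperator

/-! ### Functions with integrable Fourier density -/

open Complex in
/-- `h` represents `f` as the Fourier integral `f(x) = ∫ h(z) e^{ixz} dz`, and decays fast enough
for two differentiations under the integral sign. -/
structure IsFourierDensity (f : ℝ → ℝ) (h : ℝ → ℂ) : Prop where
  cont : Continuous h
  int : Integrable fun z : ℝ => (1 + z ^ 2) * ‖h z‖
  rep : ∀ x, (f x : ℂ) = ∫ z : ℝ, h z * exp (I * x * z)

theorem norm_exp_I_mul_mul (x z : ℝ) : ‖Complex.exp (Complex.I * x * z)‖ = 1 := by
  rw [mul_assoc, mul_comm, ← Complex.ofReal_mul, Complex.norm_exp_ofReal_mul_I]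

open Complex in
theorem integrable_mul_exp {u : ℝ → ℂ} (hu : Integrable u) (x : ℝ) :
    Integrable fun z : ℝ => u z * exp (I * x * z) :=
  hu.mul_bdd (c := 1)
    (by fun_prop : Continuous fun z : ℝ => exp (I * x * z)).aestronglyMeasurable
    (.of_forall fun z => (norm_exp_I_mul_mul x z).le)

open Complex in
/-- Smooth functions of compact support satisfy Fourier inversion; the change of variables
`z = 2πξ` accounts for the normalization of Mathlib's Fourier transform. -/
theorem HasCompactSupport.exists_isFourierDensity {f : ℝ → ℝ} (hf : ContDiff ℝ (⊤ : ℕ∞) f)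
    (hc : HasCompactSupport f) : ∃ h, IsFourierDensity f h := by
  have hc' : HasCompactSupport (fun x => (f x : ℂ)) := hc.comp_left Complex.ofReal_zero
  let S : SchwartzMap ℝ ℂ := hc'.toSchwartzMap (Complex.ofRealCLM.contDiff.comp hf)
  let T : SchwartzMap ℝ ℂ := FourierTransform.fourier S
  have hinv : ∀ x : ℝ, (f x : ℂ) = ∫ ξ : ℝ, T ξ * exp (I * x * ((2 * Real.pi * ξ : ℝ) : ℂ)) := by
    intro x
    have h1 : FourierTransformInv.fourierInv T = S := by
      simp only [T, FourierPair.fourierInv_fourier_eq]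
    have h2 : (f x : ℂ) = S x := rfl
    rw [h2, ← h1, SchwartzMap.fourierInv_coe, Real.fourierInv_eq']
    refine integral_congr_ae (.of_forall fun ξ => ?_)
    simp only [smul_eq_mul]
    rw [mul_comm]
    congr 2
    simp
    ring
  have hpi : (2 * Real.pi) ≠ 0 := by positivity
  refine ⟨fun z => ((2 * Real.pi)⁻¹ : ℝ) * T ((2 * Real.pi)⁻¹ * z), ?_, ?_, ?_⟩
  · have := T.continuous
    fun_prop
  · have h1 : Integrable fun ξ : ℝ => (1 + (2 * Real.pi * ξ) ^ 2) * ((2 * Real.pi)⁻¹ * ‖T ξ‖) := by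
      have e1 := (T.integrable (μ := volume)).norm.const_mul (2 * Real.pi)⁻¹
      have e2 := (T.integrable_pow_mul volume 2).const_mul (2 * Real.pi)
      refine (e1.add e2).congr (.of_forall fun ξ => ?_)
      simp only [Pi.add_apply, Real.norm_eq_abs, sq_abs]
      field_simp
    refine (h1.comp_mul_left' (inv_ne_zero hpi)).congr (.of_forall fun z => ?_)
    simp only [norm_mul, Complex.norm_real, Real.norm_eq_abs]
    rw [mul_inv_cancel_left₀ hpi, abs_of_pos (by positivity : (0 : ℝ) < (2 * Real.pi)⁻¹)]
  · intro x
    have h1 := Measure.integral_comp_mul_left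
      (fun ξ : ℝ => T ξ * exp (I * x * ((2 * Real.pi * ξ : ℝ) : ℂ))) (2 * Real.pi)⁻¹
    rw [← hinv x, inv_inv, abs_of_pos (by positivity : 0 < 2 * Real.pi)] at h1
    simp only [mul_inv_cancel_left₀ hpi] at h1
    simp only [mul_assoc]
    simp only [mul_assoc] at h1
    rw [integral_const_mul, h1, Complex.real_smul, ← mul_assoc, ← Complex.ofReal_mul,
      inv_mul_cancel₀ hpi, Complex.ofReal_one, one_mul]

open Complex in
theorem hasDerivAt_integral_mul_exp {h : ℝ → ℂ} (hc : Continuous h) (hi : Integrable h)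
    (hi' : Integrable fun z : ℝ => h z * (I * z)) (x : ℝ) :
    HasDerivAt (fun x : ℝ => ∫ z : ℝ, h z * exp (I * x * z))
      (∫ z : ℝ, h z * (I * z) * exp (I * x * z)) x := by
  refine (hasDerivAt_integral_of_dominated_loc_of_deriv_le
    (F := fun (x z : ℝ) => h z * exp (I * x * z))
    (F' := fun (x z : ℝ) => h z * (I * z) * exp (I * x * z)) (s := univ)
    (bound := fun z => ‖h z * (I * z)‖) univ_mem
    (.of_forall fun x => ?_) ?_ ?_ (.of_forall fun z x _ => ?_) hi'.norm
    (.of_forall fun z x _ => ?_)).2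
  · exact (by fun_prop : Continuous fun z : ℝ => h z * exp (I * x * z)).aestronglyMeasurable
  · refine hi.mono (by fun_prop : Continuous fun z : ℝ =>
      h z * exp (I * x * z)).aestronglyMeasurable (.of_forall fun z => ?_)
    rw [norm_mul, norm_exp_I_mul_mul, mul_one]
  · exact (by fun_prop : Continuous fun z : ℝ =>
      h z * (I * z) * exp (I * x * z)).aestronglyMeasurable
  · rw [norm_mul _ (exp _), norm_exp_I_mul_mul, mul_one]
  · have h1 : HasDerivAt (fun x : ℝ => I * (x : ℂ) * z) (I * 1 * z) x :=
      ((hasDerivAt_id x).ofReal_comp.const_mul I).mul_const (z : ℂ)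
    have h2 := h1.cexp.const_mul (h z)
    exact h2.congr_deriv (by ring)

namespace IsFourierDensity

open Complex

variable {f : ℝ → ℝ} {h : ℝ → ℂ}

/-- The decay of a density absorbs any factor of at most quadratic growth. -/
theorem integrable_mul (H : IsFourierDensity f h) {u : ℝ → ℂ}
    (hu : AEStronglyMeasurable u) {C : ℝ} (hC : ∀ z, ‖u z‖ ≤ C * (1 + z ^ 2)) :
    Integrable fun z => h z * u z := by
  refine (H.int.const_mul C).mono' (H.cont.aestronglyMeasurable.mul hu) (.of_forall fun z => ?_)
  rw [norm_mul]
  calc ‖h z‖ * ‖u z‖ ≤ ‖h z‖ * (C * (1 + z ^ 2)) := by gcongr; exact hC z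
    _ = _ := by ring

theorem integrable (H : IsFourierDensity f h) : Integrable h := by
  simpa using H.integrable_mul (u := fun _ => 1) aestronglyMeasurable_const (C := 1)
    (fun z => by simp; positivity)

theorem integrable_mul_I (H : IsFourierDensity f h) :
    Integrable fun z : ℝ => h z * (I * z) :=
  H.integrable_mul (by fun_prop : Continuous fun z : ℝ => I * (z : ℂ)).aestronglyMeasurable (C := 1)
    (fun z => by
      simp only [norm_mul, norm_I, one_mul, norm_real, Real.norm_eq_abs]
      nlinarith [sq_abs z, sq_nonneg (|z| - 1), abs_nonneg z])

theorem integrable_mul_I_sq (H : IsFourierDensity f h) :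
    Integrable fun z : ℝ => h z * (I * z) * (I * z) := by
  simp only [mul_assoc (h _)]
  refine H.integrable_mul (u := fun z : ℝ => I * (z : ℂ) * (I * z))
    (by fun_prop : Continuous fun z : ℝ => I * (z : ℂ) * (I * z)).aestronglyMeasurable (C := 1)
    (fun z => ?_)
  simp only [norm_mul, norm_I, one_mul, norm_real, Real.norm_eq_abs]
  nlinarith [sq_abs z, sq_nonneg (|z| - 1), abs_nonneg z]

theorem deriv_eq (H : IsFourierDensity f h) (hf : Differentiable ℝ f) (x : ℝ) :
    ((deriv f x : ℝ) : ℂ) = ∫ z : ℝ, h z * (I * z) * exp (I * x * z) := by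
  have h1 := (hf x).hasDerivAt.ofReal_comp
  simp only [H.rep] at h1
  exact h1.unique (hasDerivAt_integral_mul_exp H.cont H.integrable H.integrable_mul_I x)

theorem deriv_deriv_eq (H : IsFourierDensity f h) (hf : ContDiff ℝ 2 f) (x : ℝ) :
    ((deriv (deriv f) x : ℝ) : ℂ) =
      ∫ z : ℝ, h z * (I * z) * (I * z) * exp (I * x * z) := by
  have h1 := (hf.deriv_of_two.differentiable one_ne_zero x).hasDerivAt.ofReal_comp
  simp only [H.deriv_eq (hf.differentiable two_ne_zero)] at h1
  have hc := H.cont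
  exact h1.unique (hasDerivAt_integral_mul_exp (h := fun z : ℝ => h z * (I * z)) (by fun_prop)
    H.integrable_mul_I H.integrable_mul_I_sq x)

end IsFourierDensity

/-! ### The generator is the Fourier multiplier `-λ` -/

open Complex in
/-- The integrand `e^{iyz} - 1 - iyz 1_{|y| ≤ 1}` of the Lévy-Khinchine formula. -/
noncomputable def levyKernel (z y : ℝ) : ℂ :=
  exp (I * y * z) - 1 - (Icc (-1 : ℝ) 1).indicator (fun u : ℝ => I * u * z) y

open Complex in
/-- The kernel is the compensated increment at `0` of the function `x ↦ e^{ixz}`. -/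
theorem norm_levyKernel_le (z y : ℝ) :
    ‖levyKernel z y‖ ≤ 4 * (1 + z ^ 2) * (y ^ 2 / (1 + y ^ 2)) := by
  have hd : ∀ (c : ℂ) (x : ℝ), HasDerivAt (fun x : ℝ => c * exp (I * x * z))
      (c * (I * z) * exp (I * x * z)) x := fun c x => by
    have h1 : HasDerivAt (fun x : ℝ => I * (x : ℂ) * z) (I * 1 * z) x :=
      ((hasDerivAt_id x).ofReal_comp.const_mul I).mul_const (z : ℂ)
    exact (h1.cexp.const_mul c).congr_deriv (by ring)
  have hd1 : deriv (fun x : ℝ => exp (I * x * z)) = fun x : ℝ => I * z * exp (I * x * z) :=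
    funext fun x => by simpa using (hd 1 x).deriv
  have hd2 : deriv (deriv (fun x : ℝ => exp (I * x * z))) =
      fun x : ℝ => I * z * (I * z) * exp (I * x * z) := by
    rw [hd1]; exact funext fun x => (hd (I * z) x).deriv
  have hs : ContDiff ℝ 2 (fun x : ℝ => exp (I * x * z)) :=
    ((contDiff_const.mul Complex.ofRealCLM.contDiff).mul contDiff_const).cexp
  have h1 := norm_compensatedIncrement_le hs (a := 1) (b := z ^ 2)
    (fun x => (norm_exp_I_mul_mul x z).le)
    (fun x => by
      rw [hd2]
      simp only [norm_mul, norm_exp_I_mul_mul, norm_I, one_mul, mul_one, norm_real,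
        Real.norm_eq_abs]
      rw [← sq, sq_abs]) 0 y
  have h2 : compensatedIncrement (fun x : ℝ => exp (I * x * z)) 0 y = levyKernel z y := by
    unfold compensatedIncrement levyKernel
    rw [hd1]
    simp [mul_assoc, mul_left_comm]
  rw [h2] at h1
  refine h1.trans (mul_le_mul_of_nonneg_right ?_ (by positivity))
  nlinarith [sq_nonneg z]

open Complex in
theorem measurable_levyKernel : Measurable (Function.uncurry levyKernel) := by
  have h1 : Measurable fun p : ℝ × ℝ => I * (p.2 : ℂ) * p.1 := by fun_prop
  have h2 : Measurable fun p : ℝ × ℝ => exp (I * (p.2 : ℂ) * p.1) - 1 := by fun_prop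
  exact h2.sub (h1.indicator (measurable_snd measurableSet_Icc : MeasurableSet
    ((fun p : ℝ × ℝ => p.2) ⁻¹' Icc (-1 : ℝ) 1)))

theorem levyExponent_eq (A γ : ℝ) (N : Measure ℝ) (z : ℝ) :
    levyExponent A γ N z =
      (A / 2 * z ^ 2 : ℝ) - Complex.I * γ * z - ∫ y, levyKernel z y ∂N := rfl

theorem measurable_levyExponent (A γ : ℝ) (N : Measure ℝ) [SFinite N] :
    Measurable (levyExponent A γ N) := by
  have h1 : Measurable fun z => ∫ y, levyKernel z y ∂N :=
    (measurable_levyKernel.stronglyMeasurable.integral_prod_right (ν := N)).measurable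
  have h2 : Measurable fun z : ℝ => ((A / 2 * z ^ 2 : ℝ) : ℂ) - Complex.I * γ * z := by fun_prop
  exact h2.sub h1

theorem exists_norm_levyExponent_le (A γ : ℝ) {N : Measure ℝ}
    (hN : Integrable (fun y : ℝ => y ^ 2 / (1 + y ^ 2)) N) :
    ∃ C, ∀ z, ‖levyExponent A γ N z‖ ≤ C * (1 + z ^ 2) := by
  refine ⟨|A / 2| + |γ| + 4 * ∫ y, y ^ 2 / (1 + y ^ 2) ∂N, fun z => ?_⟩
  have h1 : ‖∫ y, levyKernel z y ∂N‖ ≤ ∫ y, 4 * (1 + z ^ 2) * (y ^ 2 / (1 + y ^ 2)) ∂N :=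
    norm_integral_le_of_norm_le (hN.const_mul _) (.of_forall (norm_levyKernel_le z))
  rw [integral_const_mul] at h1
  have h2 : ‖((A / 2 * z ^ 2 : ℝ) : ℂ)‖ ≤ |A / 2| * (1 + z ^ 2) := by
    rw [Complex.norm_real, Real.norm_eq_abs, abs_mul, abs_of_nonneg (sq_nonneg z)]
    gcongr; linarith
  have h3 : ‖Complex.I * γ * z‖ ≤ |γ| * (1 + z ^ 2) := by
    simp only [norm_mul, Complex.norm_I, one_mul, Complex.norm_real, Real.norm_eq_abs]
    gcongr
    nlinarith [sq_abs z, sq_nonneg (|z| - 1), abs_nonneg z]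
  rw [levyExponent_eq]
  refine (norm_sub_le _ _).trans ((add_le_add (norm_sub_le _ _) le_rfl).trans ?_)
  linarith

open Complex in
theorem IsFourierDensity.compensatedIncrement_eq {f : ℝ → ℝ} {h : ℝ → ℂ}
    (H : IsFourierDensity f h) (hf : ContDiff ℝ 2 f) (x y : ℝ) :
    ((compensatedIncrement f x y : ℝ) : ℂ) =
      ∫ z : ℝ, h z * exp (I * x * z) * levyKernel z y := by
  unfold compensatedIncrement levyKernel
  by_cases hy : y ∈ Icc (-1 : ℝ) 1
  · simp only [indicator_of_mem hy, smul_eq_mul]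
    push_cast
    have hs : Integrable fun z : ℝ =>
        h z * exp (I * (x + y : ℝ) * z) - h z * exp (I * x * z) :=
      (integrable_mul_exp H.integrable _).sub (integrable_mul_exp H.integrable _)
    rw [H.rep, H.rep, H.deriv_eq (hf.differentiable two_ne_zero), ← integral_const_mul,
      ← integral_sub (integrable_mul_exp H.integrable _) (integrable_mul_exp H.integrable _),
      ← integral_sub hs ((integrable_mul_exp H.integrable_mul_I _).const_mul _)]
    refine integral_congr_ae (.of_forall fun z => ?_)
    simp only [ofReal_add, mul_add, add_mul, exp_add]
    ring
  · simp only [indicator_of_notMem hy, sub_zero]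
    push_cast
    rw [H.rep, H.rep, ← integral_sub (integrable_mul_exp H.integrable _)
      (integrable_mul_exp H.integrable _)]
    refine integral_congr_ae (.of_forall fun z => ?_)
    simp only [ofReal_add, mul_add, add_mul, exp_add]
    ring

open Complex in
/-- On the Fourier side, `levyOperator A γ N` is multiplication by `-λ`. -/
theorem IsFourierDensity.levyOperator_eq {f : ℝ → ℝ} {h : ℝ → ℂ}
    (H : IsFourierDensity f h) (hf : ContDiff ℝ 2 f) (A γ : ℝ) {N : Measure ℝ} [SFinite N]
    (hN : Integrable (fun y : ℝ => y ^ 2 / (1 + y ^ 2)) N) (x : ℝ) :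
    ((levyOperator A γ N f x : ℝ) : ℂ) =
      ∫ z : ℝ, h z * -levyExponent A γ N z * exp (I * x * z) := by
  have hprod : Integrable (Function.uncurry fun z y : ℝ => h z * exp (I * x * z) * levyKernel z y)
      (volume.prod N) := by
    refine (H.int.mul_prod (hN.const_mul 4)).mono' ?_ (.of_forall fun p => ?_)
    · have h1 : Measurable fun p : ℝ × ℝ => h p.1 * exp (I * x * p.1) := by
        have := H.cont.measurable
        fun_prop
      exact (h1.mul measurable_levyKernel).aestronglyMeasurable
    · simp only [Function.uncurry, norm_mul, norm_exp_I_mul_mul, mul_one]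
      calc _ ≤ ‖h p.1‖ * (4 * (1 + p.1 ^ 2) * (p.2 ^ 2 / (1 + p.2 ^ 2))) := by
            gcongr; exact norm_levyKernel_le _ _
        _ = _ := by ring
  have hswap : ((∫ y, compensatedIncrement f x y ∂N : ℝ) : ℂ) =
      ∫ z : ℝ, h z * exp (I * x * z) * ∫ y, levyKernel z y ∂N := by
    rw [← integral_complex_ofReal]
    simp only [H.compensatedIncrement_eq hf]
    rw [← integral_integral_swap hprod]
    simp only [integral_const_mul]
  have hint : Integrable fun z : ℝ => h z * exp (I * x * z) * ∫ y, levyKernel z y ∂N := by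
    have := hprod.integral_prod_left
    simpa only [Function.uncurry, integral_const_mul] using this
  unfold levyOperator
  push_cast
  rw [hswap, H.deriv_deriv_eq hf, H.deriv_eq (hf.differentiable two_ne_zero),
    ← integral_const_mul, ← integral_const_mul,
    ← integral_add ((integrable_mul_exp H.integrable_mul_I_sq _).const_mul _)
        ((integrable_mul_exp H.integrable_mul_I _).const_mul _),
    ← integral_add (((integrable_mul_exp H.integrable_mul_I_sq _).const_mul _).fun_add
        ((integrable_mul_exp H.integrable_mul_I _).const_mul _)) hint]
  refine integral_congr_ae (.of_forall fun z => ?_)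
  simp only [levyExponent_eq]
  push_cast
  linear_combination (A / 2 * h z * z ^ 2 * exp (I * x * z)) * I_sq

/-! ### The transition operators on functions with integrable Fourier density -/

open Complex in
/-- On the Fourier side, averaging the translates by a law `μ` is multiplication by its
characteristic function. -/
theorem integral_comp_const_add_eq_integral_charFun {g : ℝ → ℝ} {h : ℝ → ℂ} (hi : Integrable h)
    (hg : ∀ x, (g x : ℂ) = ∫ z : ℝ, h z * exp (I * x * z))
    (μ : Measure ℝ) [IsProbabilityMeasure μ] (x : ℝ) :
    ((∫ y, g (x + y) ∂μ : ℝ) : ℂ) = ∫ z : ℝ, h z * exp (I * x * z) * charFun μ z := by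
  rw [← integral_complex_ofReal]
  simp only [hg]
  have hprod : Integrable (Function.uncurry fun y z : ℝ => h z * exp (I * (x + y : ℝ) * z))
      (μ.prod volume) := by
    refine ((integrable_const (1 : ℂ)).mul_prod hi).mul_bdd (c := 1)
      (g := fun p : ℝ × ℝ => exp (I * (x + p.1 : ℝ) * p.2)) ?_ (.of_forall fun p => ?_) |>.congr ?_
    · exact (by fun_prop : Continuous fun p : ℝ × ℝ =>
        exp (I * (x + p.1 : ℝ) * p.2)).aestronglyMeasurable
    · exact (norm_exp_I_mul_mul _ _).le
    · exact .of_forall fun p => by simp [Function.uncurry]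
  rw [integral_integral_swap hprod]
  refine integral_congr_ae (.of_forall fun z => ?_)
  simp only
  rw [charFun_apply_real, ← integral_const_mul]
  refine integral_congr_ae (.of_forall fun y => ?_)
  simp only
  rw [mul_assoc (h z), ← exp_add]
  congr 2
  push_cast
  ring

section Semigroup

open Complex

variable {μ : ℝ≥0 → Measure ℝ} [∀ t, IsProbabilityMeasure (μ t)] {A γ : ℝ} {N : Measure ℝ}

/-- The bound comes from `e^{-sλ}` being a characteristic function; no estimate of `Re λ` is
needed. -/
theorem norm_exp_neg_mul_levyExponent_le
    (hμ : ∀ (t : ℝ≥0) (z : ℝ), charFun (μ t) z = exp (-((t : ℝ) : ℂ) * levyExponent A γ N z))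
    {s : ℝ} (hs : 0 ≤ s) (z : ℝ) : ‖exp (-(s : ℂ) * levyExponent A γ N z)‖ ≤ 1 := by
  have := norm_charFun_le_one (μ := μ s.toNNReal) z
  rwa [hμ, Real.coe_toNNReal s hs] at this

theorem intervalIntegral_exp_neg_mul (w : ℂ) (t : ℝ) :
    ∫ s in (0 : ℝ)..t, -w * exp (-(s : ℂ) * w) = exp (-(t : ℂ) * w) - 1 := by
  have h1 : ∀ s : ℝ, HasDerivAt (fun s : ℝ => exp (-(s : ℂ) * w)) (-w * exp (-(s : ℂ) * w)) s := by
    intro s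
    have h2 : HasDerivAt (fun s : ℝ => -(s : ℂ) * w) (-1 * w) s :=
      ((hasDerivAt_id s).ofReal_comp.neg).mul_const w
    exact h2.cexp.congr_deriv (by ring)
  rw [intervalIntegral.integral_eq_sub_of_hasDerivAt (fun s _ => h1 s)
    ((by fun_prop : Continuous fun s : ℝ => -w * exp (-(s : ℂ) * w)).intervalIntegrable 0 t)]
  simp

theorem norm_exp_neg_mul_levyExponent_sub_one_le
    (hμ : ∀ (t : ℝ≥0) (z : ℝ), charFun (μ t) z = exp (-((t : ℝ) : ℂ) * levyExponent A γ N z))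
    (t : ℝ≥0) (z : ℝ) :
    ‖exp (-((t : ℝ) : ℂ) * levyExponent A γ N z) - 1‖ ≤ ‖levyExponent A γ N z‖ * t := by
  rw [← intervalIntegral_exp_neg_mul]
  refine (intervalIntegral.norm_integral_le_of_norm_le_const
    (C := ‖levyExponent A γ N z‖) fun s hs => ?_).trans_eq (by simp)
  rw [uIoc_of_le t.coe_nonneg] at hs
  rw [norm_mul, norm_neg]
  exact mul_le_of_le_one_right (norm_nonneg _) (norm_exp_neg_mul_levyExponent_le hμ hs.1.le z)

variable {f : ℝ → ℝ} {h : ℝ → ℂ}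

/-- Dynkin's formula `P_t f - f = ∫₀ᵗ P_s G f ds` for `G = levyOperator A γ N`, read off from the Fourier
representation, gives the bound `‖P_t f - f‖ ≤ t ‖G f‖`. -/
theorem IsFourierDensity.abs_integral_sub_le [SFinite N] (H : IsFourierDensity f h)
    (hf : ContDiff ℝ 2 f)
    (hμ : ∀ (t : ℝ≥0) (z : ℝ), charFun (μ t) z = exp (-((t : ℝ) : ℂ) * levyExponent A γ N z))
    (hN : Integrable (fun y : ℝ => y ^ 2 / (1 + y ^ 2)) N) {M : ℝ}
    (hM : ∀ x, |levyOperator A γ N f x| ≤ M) (t : ℝ≥0) (x : ℝ) :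
    |∫ y, f (x + y) ∂μ t - f x| ≤ M * t := by
  obtain ⟨C, hC⟩ := exists_norm_levyExponent_le A γ hN
  have hlm := measurable_levyExponent A γ N
  have hli : Integrable fun z => h z * -levyExponent A γ N z :=
    H.integrable_mul hlm.neg.aestronglyMeasurable (C := C) (fun z => by simpa using hC z)
  have hcm := H.cont.measurable
  have hprod : Integrable (Function.uncurry fun (s z : ℝ) =>
      h z * -levyExponent A γ N z * exp (I * x * z) * exp (-(s : ℂ) * levyExponent A γ N z))
      ((volume.restrict (uIoc 0 (t : ℝ))).prod volume) := by
    have : IsFiniteMeasure (volume.restrict (uIoc 0 (t : ℝ))) := by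
      rw [uIoc_of_le t.coe_nonneg]; infer_instance
    refine ((integrable_const (1 : ℝ)).mul_prod hli.norm).mono' ?_ ?_
    · refine Measurable.aestronglyMeasurable ?_
      unfold Function.uncurry
      fun_prop
    · have h1 : ∀ᵐ p : ℝ × ℝ ∂((volume.restrict (uIoc 0 (t : ℝ))).prod volume),
          p.1 ∈ uIoc 0 (t : ℝ) :=
        Measure.quasiMeasurePreserving_fst.ae (ae_restrict_mem measurableSet_uIoc)
      filter_upwards [h1] with p hp
      rw [uIoc_of_le t.coe_nonneg] at hp
      simp only [Function.uncurry, norm_mul, norm_exp_I_mul_mul, mul_one, one_mul]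
      refine mul_le_of_le_one_right (by positivity) ?_
      exact norm_exp_neg_mul_levyExponent_le hμ hp.1.le _
  have hE := integrable_mul_exp H.integrable x
  have key : ((∫ y, f (x + y) ∂μ t - f x : ℝ) : ℂ) =
      ∫ s in (0 : ℝ)..t, ((∫ y, levyOperator A γ N f (x + y) ∂μ s.toNNReal : ℝ) : ℂ) := by
    have e1 : ((∫ y, f (x + y) ∂μ t - f x : ℝ) : ℂ) =
        ∫ z : ℝ, ∫ s in (0 : ℝ)..t,
          h z * -levyExponent A γ N z * exp (I * x * z) *
            exp (-(s : ℂ) * levyExponent A γ N z) := by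
      push_cast
      rw [integral_comp_const_add_eq_integral_charFun H.integrable H.rep, H.rep,
        ← integral_sub (hE.mul_bdd (c := 1) ?_ (.of_forall fun z => norm_charFun_le_one z)) hE]
      · refine integral_congr_ae (.of_forall fun z => ?_)
        have e2 : ∀ s : ℝ, h z * -levyExponent A γ N z * exp (I * x * z) *
            exp (-(s : ℂ) * levyExponent A γ N z) = h z * exp (I * x * z) *
              (-levyExponent A γ N z * exp (-(s : ℂ) * levyExponent A γ N z)) := fun s => by ring
        simp only [e2]
        rw [intervalIntegral.integral_const_mul, intervalIntegral_exp_neg_mul, hμ]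
        ring
      · exact measurable_charFun.aestronglyMeasurable
    rw [e1]
    rw [← intervalIntegral_integral_swap hprod]
    refine intervalIntegral.integral_congr fun s hs => ?_
    rw [uIcc_of_le t.coe_nonneg] at hs
    rw [integral_comp_const_add_eq_integral_charFun hli (fun x => H.levyOperator_eq hf A γ hN x)]
    simp only [hμ, Real.coe_toNNReal s hs.1]
  rw [← Real.norm_eq_abs, ← Complex.norm_real, key]
  refine (intervalIntegral.norm_integral_le_of_norm_le_const (C := M) fun s _ => ?_).trans_eq
    (by simp)
  rw [Complex.norm_real]
  refine (norm_integral_le_of_norm_le_const (.of_forall fun y => hM (x + y))).trans_eq (by simp)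

/-- The convergence is uniform in `x` because the Fourier density of the error does not depend on
`x`, up to a factor of modulus `1`. -/
theorem IsFourierDensity.tendstoUniformly [SFinite N] (H : IsFourierDensity f h)
    (hf : ContDiff ℝ 2 f)
    (hμ : ∀ (t : ℝ≥0) (z : ℝ), charFun (μ t) z = exp (-((t : ℝ) : ℂ) * levyExponent A γ N z))
    (hN : Integrable (fun y : ℝ => y ^ 2 / (1 + y ^ 2)) N) :
    TendstoUniformly (fun (t : ℝ≥0) (x : ℝ) => (∫ y, f (x + y) ∂μ t - f x) / (t : ℝ))
      (levyOperator A γ N f) (𝓝[>] 0) := by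
  obtain ⟨C, hC⟩ := exists_norm_levyExponent_le A γ hN
  have hlm := measurable_levyExponent A γ N
  have hli : Integrable fun z => h z * levyExponent A γ N z :=
    H.integrable_mul hlm.aestronglyMeasurable hC
  have hcm := H.cont.measurable
  -- The error at `x` is the Fourier integral of `h q_t`, so it is bounded by `∫ ‖h q_t‖`.
  let q : ℝ≥0 → ℝ → ℂ := fun t z =>
    (exp (-((t : ℝ) : ℂ) * levyExponent A γ N z) - 1) / ((t : ℝ) : ℂ) + levyExponent A γ N z
  have hqb : ∀ t z, ‖h z * q t z‖ ≤ 2 * ‖h z * levyExponent A γ N z‖ := fun t z => by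
    rw [norm_mul, norm_mul, mul_left_comm]
    refine mul_le_mul_of_nonneg_left ((norm_add_le _ _).trans ?_) (norm_nonneg _)
    rw [two_mul]
    refine add_le_add ?_ le_rfl
    rw [norm_div, Complex.norm_real, Real.norm_of_nonneg t.coe_nonneg]
    refine div_le_of_le_mul₀ t.coe_nonneg (norm_nonneg _) ?_
    exact norm_exp_neg_mul_levyExponent_sub_one_le hμ t z
  have hqm : ∀ t, AEStronglyMeasurable (fun z => h z * q t z) := fun t => by
    refine Measurable.aestronglyMeasurable ?_
    simp only [q]
    fun_prop
  have hqi : ∀ t, Integrable fun z => h z * q t z := fun t =>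
    (hli.norm.const_mul 2).mono' (hqm t) (.of_forall (hqb t))
  have hlim : Tendsto (fun t => ∫ z, ‖h z * q t z‖) (𝓝[>] 0) (𝓝 0) := by
    have : Tendsto (fun t => ∫ z, ‖h z * q t z‖) (𝓝[>] 0) (𝓝 (∫ _ : ℝ, (0 : ℝ))) := by
      refine tendsto_integral_filter_of_dominated_convergence
        (fun z => 2 * ‖h z * levyExponent A γ N z‖) (.of_forall fun t => (hqm t).norm)
        (.of_forall fun t => .of_forall fun z => by simpa using hqb t z)
        (hli.norm.const_mul 2) (.of_forall fun z => ?_)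
      have h1 : HasDerivAt (fun s : ℝ => exp (-(s : ℂ) * levyExponent A γ N z))
          (-levyExponent A γ N z) 0 := by
        have h2 : HasDerivAt (fun s : ℝ => -(s : ℂ) * levyExponent A γ N z)
            (-1 * levyExponent A γ N z) 0 :=
          ((hasDerivAt_id (0 : ℝ)).ofReal_comp.neg).mul_const _
        simpa using h2.cexp
      have h3 : Tendsto ((↑) : ℝ≥0 → ℝ) (𝓝[>] 0) (𝓝[≠] 0) := by
        refine tendsto_nhdsWithin_iff.2 ⟨?_, ?_⟩
        · exact (NNReal.continuous_coe.tendsto 0).mono_left nhdsWithin_le_nhds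
        · filter_upwards [self_mem_nhdsWithin] with t ht
          exact NNReal.coe_ne_zero.2 (ne_of_gt ht)
      have h4 := (hasDerivAt_iff_tendsto_slope.1 h1).comp h3
      have h5 := ((h4.add_const (levyExponent A γ N z)).const_mul (h z)).norm
      simp only [neg_add_cancel, mul_zero, norm_zero] at h5
      refine h5.congr fun t => ?_
      simp only [q, Function.comp, slope_def_module, Complex.real_smul]
      congr 3
      simp
      ring
    simpa using this
  have hle : ∀ t x, dist (levyOperator A γ N f x) ((∫ y, f (x + y) ∂μ t - f x) / (t : ℝ)) ≤
      ∫ z, ‖h z * q t z‖ := by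
    intro t x
    have e1 : (((∫ y, f (x + y) ∂μ t - f x) / (t : ℝ) - levyOperator A γ N f x : ℝ) : ℂ) =
        ∫ z : ℝ, h z * q t z * exp (I * x * z) := by
      push_cast
      rw [integral_comp_const_add_eq_integral_charFun H.integrable H.rep, H.rep,
        H.levyOperator_eq hf A γ hN,
        ← integral_sub ((integrable_mul_exp H.integrable x).mul_bdd (c := 1)
          measurable_charFun.aestronglyMeasurable (.of_forall fun z => norm_charFun_le_one z))
          (integrable_mul_exp H.integrable x), ← integral_div, ← integral_sub]
      · refine integral_congr_ae (.of_forall fun z => ?_)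
        simp only [q, hμ]
        ring
      · exact (((integrable_mul_exp H.integrable x).mul_bdd (c := 1)
          measurable_charFun.aestronglyMeasurable (.of_forall fun z => norm_charFun_le_one z)).sub
          (integrable_mul_exp H.integrable x)).div_const _
      · exact integrable_mul_exp (by simpa using hli.neg) x
    rw [dist_comm, Real.dist_eq, ← Real.norm_eq_abs, ← Complex.norm_real, e1]
    refine (norm_integral_le_integral_norm _).trans_eq (integral_congr_ae (.of_forall fun z => ?_))
    simp only
    rw [norm_mul _ (exp _), norm_exp_I_mul_mul, mul_one]
  rw [Metric.tendstoUniformly_iff]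
  intro ε hε
  filter_upwards [hlim.eventually (gt_mem_nhds hε)] with t ht x
  exact (hle t x).trans_lt ht

end Semigroup

/-! ### The generator on twice continuously differentiable functions -/

open scoped Convolution in
open ContinuousLinearMap in
/-- Mollification approximates a compactly supported `C²` function together with its first two
derivatives, uniformly. -/
theorem HasCompactSupport.exists_contDiff_approx_two {f : ℝ → ℝ} (hf : ContDiff ℝ 2 f)
    (hc : HasCompactSupport f) {ε : ℝ} (hε : 0 < ε) :
    ∃ g : ℝ → ℝ, ContDiff ℝ (⊤ : ℕ∞) g ∧ HasCompactSupport g ∧ (∀ x, ‖(g - f) x‖ ≤ ε) ∧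
      (∀ x, ‖deriv (g - f) x‖ ≤ ε) ∧ ∀ x, ‖deriv (deriv (g - f)) x‖ ≤ ε := by
  have hf' := hf.deriv_of_two
  have u0 := Metric.uniformContinuous_iff.1
    (hf.continuous.uniformContinuous_of_tendsto_cocompact hc.is_zero_at_infty) ε hε
  have u1 := Metric.uniformContinuous_iff.1
    (hf'.continuous.uniformContinuous_of_tendsto_cocompact hc.deriv.is_zero_at_infty) ε hε
  have u2 := Metric.uniformContinuous_iff.1
    (hf.continuous_deriv_deriv.uniformContinuous_of_tendsto_cocompact
      hc.deriv.deriv.is_zero_at_infty) ε hε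
  obtain ⟨δ₀, hδ₀, h0⟩ := u0
  obtain ⟨δ₁, hδ₁, h1⟩ := u1
  obtain ⟨δ₂, hδ₂, h2⟩ := u2
  obtain ⟨δ, hδ, l0, l1, l2⟩ : ∃ δ > 0, δ ≤ δ₀ ∧ δ ≤ δ₁ ∧ δ ≤ δ₂ :=
    ⟨min δ₀ (min δ₁ δ₂), lt_min hδ₀ (lt_min hδ₁ hδ₂), min_le_left _ _,
      (min_le_right _ _).trans (min_le_left _ _), (min_le_right _ _).trans (min_le_right _ _)⟩
  obtain ⟨φ, hφδ⟩ : ∃ φ : ContDiffBump (0 : ℝ), φ.rOut = δ :=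
    ⟨⟨δ / 2, δ, by positivity, by linarith⟩, rfl⟩
  obtain ⟨g, hg⟩ : ∃ g, g = φ.normed volume ⋆[lsmul ℝ ℝ, volume] f := ⟨_, rfl⟩
  have hφ : LocallyIntegrable (φ.normed volume) := φ.continuous_normed.locallyIntegrable
  have hg1 : deriv g = φ.normed volume ⋆[lsmul ℝ ℝ, volume] (deriv f) := by
    rw [hg]
    exact funext fun x =>
      (hc.hasDerivAt_convolution_right (lsmul ℝ ℝ) hφ (hf.of_le one_le_two) x).deriv
  have hg2 : deriv (deriv g) = φ.normed volume ⋆[lsmul ℝ ℝ, volume] (deriv (deriv f)) := by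
    rw [hg1]
    exact funext fun x => (hc.deriv.hasDerivAt_convolution_right (lsmul ℝ ℝ) hφ hf' x).deriv
  have hgs : ContDiff ℝ (⊤ : ℕ∞) g := by
    rw [hg]
    exact φ.hasCompactSupport_normed.contDiff_convolution_left _ φ.contDiff_normed
      hf.continuous.locallyIntegrable
  have hgs2 : ContDiff ℝ 2 g := mod_cast contDiff_infty.1 hgs 2
  have hd1 : deriv (g - f) = deriv g - deriv f := funext fun x =>
    deriv_sub (hgs2.differentiable two_ne_zero x)
      (hf.differentiable two_ne_zero x)
  have hd2 : deriv (deriv (g - f)) = deriv (deriv g) - deriv (deriv f) := by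
    rw [hd1]
    exact funext fun x => deriv_sub (hgs2.deriv_of_two.differentiable one_ne_zero x)
      (hf'.differentiable one_ne_zero x)
  have hgc : HasCompactSupport g := by
    rw [hg]
    exact φ.hasCompactSupport_normed.convolution _ hc
  refine ⟨g, hgs, hgc, fun x => ?_, fun x => ?_,
    fun x => ?_⟩
  · rw [Pi.sub_apply, ← dist_eq_norm, hg]
    exact φ.dist_normed_convolution_le hf.continuous.aestronglyMeasurable fun y hy =>
      (h0 (lt_of_lt_of_le hy (hφδ.trans_le l0))).le
  · rw [hd1, hg1, Pi.sub_apply, ← dist_eq_norm]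
    exact φ.dist_normed_convolution_le hf'.continuous.aestronglyMeasurable fun y hy =>
      (h1 (lt_of_lt_of_le hy (hφδ.trans_le l1))).le
  · rw [hd2, hg2, Pi.sub_apply, ← dist_eq_norm]
    exact φ.dist_normed_convolution_le hf.continuous_deriv_deriv.aestronglyMeasurable fun y hy =>
      (h2 (lt_of_lt_of_le hy (hφδ.trans_le l2))).le

theorem HasCompactSupport.integrable_comp_const_add {μ : Measure ℝ} [IsFiniteMeasure μ]
    {u : ℝ → ℝ} (hc : HasCompactSupport u) (hu : Continuous u) (x : ℝ) :
    Integrable (fun y => u (x + y)) μ := by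
  obtain ⟨b, hb⟩ := hc.exists_bound_of_continuous hu
  exact .of_bound (by fun_prop) b (.of_forall fun y => hb _)

section Generator

variable {μ : ℝ≥0 → Measure ℝ} [∀ t, IsProbabilityMeasure (μ t)] {A γ : ℝ} {N : Measure ℝ}
  [SFinite N] {f : ℝ → ℝ}

open Complex in
/-- The bound `‖P_t f - f‖ ≤ t ‖G f‖` extends from smooth functions by mollification. -/
theorem HasCompactSupport.abs_integral_sub_le (hf : ContDiff ℝ 2 f) (hc : HasCompactSupport f)
    (hμ : ∀ (t : ℝ≥0) (z : ℝ), charFun (μ t) z = exp (-((t : ℝ) : ℂ) * levyExponent A γ N z))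
    (hN : Integrable (fun y : ℝ => y ^ 2 / (1 + y ^ 2)) N) {M : ℝ}
    (hM : ∀ x, |levyOperator A γ N f x| ≤ M) (t : ℝ≥0) (x : ℝ) :
    |∫ y, f (x + y) ∂μ t - f x| ≤ M * t := by
  set C := |A / 2| + |γ| + 6 * ∫ y, y ^ 2 / (1 + y ^ 2) ∂N
  have hC0 : 0 ≤ C := by
    have : 0 ≤ ∫ y, y ^ 2 / (1 + y ^ 2) ∂N := integral_nonneg fun y => by positivity
    positivity
  have key : ∀ ε : ℝ, 0 < ε → |∫ y, f (x + y) ∂μ t - f x| ≤ M * t + (C * t + 2) * ε := by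
    intro ε hε
    obtain ⟨g, hg, hgc, h0, h1, h2⟩ := hc.exists_contDiff_approx_two hf hε
    have hg2 : ContDiff ℝ 2 g := mod_cast contDiff_infty.1 hg 2
    obtain ⟨h, H⟩ := hgc.exists_isFourierDensity hg
    have hgf : ContDiff ℝ 2 (g - f) := hg2.sub hf
    have e1 : ∀ x, |levyOperator A γ N g x| ≤ M + C * ε := fun x => by
      have := abs_levyOperator_le (A := A) (γ := γ) hN hgf h0 h1 h2 x
      rw [levyOperator_sub hN hg2 hgc hf hc] at this
      calc _ = |(levyOperator A γ N g x - levyOperator A γ N f x) + levyOperator A γ N f x| := by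
            rw [sub_add_cancel]
        _ ≤ _ := (abs_add_le _ _).trans (by linarith [hM x])
    have e2 := H.abs_integral_sub_le hg2 hμ hN e1 t x
    have e3 : |∫ y, g (x + y) ∂μ t - ∫ y, f (x + y) ∂μ t| ≤ ε := by
      rw [← integral_sub (hgc.integrable_comp_const_add hg.continuous x)
        (hc.integrable_comp_const_add hf.continuous x)]
      exact (norm_integral_le_of_norm_le_const (.of_forall fun y => h0 (x + y))).trans_eq (by simp)
    have e4 : |g x - f x| ≤ ε := h0 x
    rw [abs_le] at *
    constructor <;> nlinarith [e2.1, e2.2, e3.1, e3.2, e4.1, e4.2]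
  have hlim : Tendsto (fun ε : ℝ => M * t + (C * t + 2) * ε) (𝓝[>] 0) (𝓝 (M * t)) := by
    have : Continuous fun ε : ℝ => M * t + (C * t + 2) * ε := by fun_prop
    simpa using (this.tendsto 0).mono_left nhdsWithin_le_nhds
  exact ge_of_tendsto hlim (by filter_upwards [self_mem_nhdsWithin] with ε hε using key ε hε)

open Complex in
/-- The `C²` case follows from the smooth one by approximation: the errors from `g - f` in the
difference quotients and in `levyOperator` have the same bound, which is independent of `t`. -/
theorem HasCompactSupport.tendstoUniformly_levyOperator (hf : ContDiff ℝ 2 f)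
    (hc : HasCompactSupport f)
    (hμ : ∀ (t : ℝ≥0) (z : ℝ), charFun (μ t) z = exp (-((t : ℝ) : ℂ) * levyExponent A γ N z))
    (hN : Integrable (fun y : ℝ => y ^ 2 / (1 + y ^ 2)) N) :
    TendstoUniformly (fun (t : ℝ≥0) (x : ℝ) => (∫ y, f (x + y) ∂μ t - f x) / (t : ℝ))
      (levyOperator A γ N f) (𝓝[>] 0) := by
  set C := |A / 2| + |γ| + 6 * ∫ y, y ^ 2 / (1 + y ^ 2) ∂N
  have hC0 : 0 ≤ C := by
    have : 0 ≤ ∫ y, y ^ 2 / (1 + y ^ 2) ∂N := integral_nonneg fun y => by positivity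
    positivity
  rw [Metric.tendstoUniformly_iff]
  intro ε hε
  -- Both `G (g - f)` and the difference quotients of `g - f` are at most `C η ≤ ε / 3`.
  let η := ε / (3 * (C + 1))
  have hη : 0 < η := by positivity
  have hCη : C * η ≤ ε / 3 := by
    have : C * η = ε / 3 * (C / (C + 1)) := by simp only [η]; field_simp
    rw [this]
    exact mul_le_of_le_one_right (by positivity) (div_le_one_of_le₀ (by linarith) (by linarith))
  obtain ⟨g, hg, hgc, h0, h1, h2⟩ := hc.exists_contDiff_approx_two hf hη
  have hg2 : ContDiff ℝ 2 g := mod_cast contDiff_infty.1 hg 2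
  obtain ⟨h, H⟩ := hgc.exists_isFourierDensity hg
  have e1 : ∀ x, |levyOperator A γ N (g - f) x| ≤ C * η :=
    abs_levyOperator_le hN (hg2.sub hf) h0 h1 h2
  have hgfc : HasCompactSupport (g - f) := hgc.sub hc
  filter_upwards [Metric.tendstoUniformly_iff.1 (H.tendstoUniformly hg2 hμ hN) (ε / 3)
    (by positivity), self_mem_nhdsWithin] with t ht ht0 x
  have ht0' : (0 : ℝ) < t := ht0
  have e2 := hgfc.abs_integral_sub_le (hg2.sub hf) hμ hN e1 t x
  have e3 : ∫ y, (g - f) (x + y) ∂μ t = ∫ y, g (x + y) ∂μ t - ∫ y, f (x + y) ∂μ t :=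
    integral_sub (hgc.integrable_comp_const_add hg.continuous x)
        (hc.integrable_comp_const_add hf.continuous x)
  have e4 : |(∫ y, g (x + y) ∂μ t - g x) / t - (∫ y, f (x + y) ∂μ t - f x) / t| ≤ ε / 3 := by
    rw [← sub_div, abs_div, abs_of_pos ht0', div_le_iff₀ ht0']
    calc _ = |∫ y, (g - f) (x + y) ∂μ t - (g - f) x| := by
          rw [e3, Pi.sub_apply]; congr 1; ring
      _ ≤ C * η * t := e2
      _ ≤ _ := by gcongr
  have e5 := (e1 x).trans hCη
  rw [levyOperator_sub hN hg2 hgc hf hc] at e5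
  have e6 := ht x
  rw [Real.dist_eq] at e6 ⊢
  rw [abs_le] at e4 e5
  rw [abs_lt] at e6 ⊢
  constructor <;> linarith [e4.1, e4.2, e5.1, e5.2, e6.1, e6.2]

end Generator

/-- `levyOperator A γ N f` as an element of `C₀(ℝ)`. -/
noncomputable def levyOperatorZeroAtInfty (A γ : ℝ) {N : Measure ℝ}
    (hN : Integrable (fun y : ℝ => y ^ 2 / (1 + y ^ 2)) N) {f : ℝ → ℝ}
    (hf : ContDiff ℝ 2 f) (hc : HasCompactSupport f) : C₀(ℝ, ℝ) where
  toFun := levyOperator A γ N f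
  continuous_toFun := continuous_levyOperator hN hf hc
  zero_at_infty' := tendsto_levyOperator_cocompact hN hf hc

theorem isGeneratorValue_levyOperator {Ω : Type*} [MeasurableSpace Ω] {P : Measure Ω}
    [IsProbabilityMeasure P] {X : ℝ≥0 → Ω → ℝ} (hX : ∀ t, Measurable (X t)) {A γ : ℝ}
    {N : Measure ℝ} [SFinite N] (hN : Integrable (fun y : ℝ => y ^ 2 / (1 + y ^ 2)) N)
    (hXN : HasLevyTriplet X P A γ N) (f : C₀(ℝ, ℝ)) (hf : ContDiff ℝ 2 f)
    (hc : HasCompactSupport f) :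
    IsGeneratorValue X P f (levyOperatorZeroAtInfty A γ hN hf hc) := by
  have (t : ℝ≥0) : IsProbabilityMeasure (P.map (X t)) :=
    Measure.isProbabilityMeasure_map (hX t).aemeasurable
  have h1 := hc.tendstoUniformly_levyOperator hf (μ := fun t => P.map (X t)) hXN hN
  have h2 : ∀ (t : ℝ≥0) (x : ℝ), transitionOp X P t f x = ∫ y, f (x + y) ∂P.map (X t) := by
    intro t x
    have hfc := hf.continuous
    unfold transitionOp transitionProb
    rw [integral_map ((hX t).const_add x).aemeasurable hfc.aestronglyMeasurable,
      integral_map (hX t).aemeasurable (by fun_prop)]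
  unfold IsGeneratorValue
  simp only [h2]
  exact h1

/-! ### Integrating the jump part by parts -/

theorem locallyIntegrable_comp_neg {κ : ℝ → ℝ} (hκ : LocallyIntegrable κ) :
    LocallyIntegrable fun x => κ (-x) := by
  intro x
  obtain ⟨s, hs, hi⟩ := hκ (-x)
  refine ⟨Neg.neg ⁻¹' s, continuous_neg.continuousAt.preimage_mem_nhds hs, ?_⟩
  exact ((Measure.measurePreserving_neg (volume : Measure ℝ)).integrableOn_comp_preimage
    (Homeomorph.neg ℝ).measurableEmbedding).2 hi

theorem locallyIntegrable_of_integrableOn_Icc_neg {κ : ℝ → ℝ}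
    (h : ∀ M : ℝ, 0 < M → IntegrableOn κ (Icc (-M) M)) : LocallyIntegrable κ := fun x =>
  ⟨Icc (-(|x| + 1)) (|x| + 1),
    Icc_mem_nhds (by linarith [neg_abs_le x]) (by linarith [le_abs_self x]),
    h _ (by positivity)⟩

theorem integrable_compensatedIncrement_mul_deriv {ν φ : ℝ → ℝ}
    (hi : Integrable fun y => y ^ 2 / (1 + y ^ 2) * deriv ν y)
    (hφ : ContDiff ℝ 2 φ) (hc : HasCompactSupport φ) (x : ℝ) :
    Integrable fun y => compensatedIncrement φ x y * deriv ν y := by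
  obtain ⟨C, hC⟩ := hc.exists_norm_compensatedIncrement_le hφ
  refine (hi.norm.const_mul C).mono' ((stronglyMeasurable_compensatedIncrement hφ x).mul
    (measurable_deriv ν).stronglyMeasurable).aestronglyMeasurable (.of_forall fun y => ?_)
  rw [norm_mul, norm_mul, ← mul_assoc,
    Real.norm_of_nonneg (by positivity : 0 ≤ y ^ 2 / (1 + y ^ 2))]
  gcongr
  exact hC x y

/-- Two integrations by parts on `(0, ∞)`. The boundary terms at `0` vanish because the
compensated increment is `O(y²)` and its derivative is `O(y)`; those at `1`, where the
compensation stops, produce the multiple of `φ'(0)`. -/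
theorem integral_Ioi_compensatedIncrement_mul_deriv {ν κ φ : ℝ → ℝ}
    (hν : ∀ y, 0 < y → DifferentiableAt ℝ ν y) (hκ : ∀ y, 0 < y → HasDerivAt κ (ν y) y)
    (hi : Integrable fun y => y ^ 2 / (1 + y ^ 2) * deriv ν y)
    (hκi : LocallyIntegrable κ)
    (hκ0 : Tendsto (fun y => y * κ y) (𝓝[>] 0) (𝓝 0))
    (hν0 : Tendsto (fun y => y ^ 2 * ν y) (𝓝[>] 0) (𝓝 0))
    (hνtop : Tendsto ν atTop (𝓝 0)) (hφ : ContDiff ℝ 2 φ) (hc : HasCompactSupport φ) :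
    ∫ y in Ioi 0, compensatedIncrement φ 0 y * deriv ν y =
      deriv φ 0 * (κ 1 - ν 1) + ∫ y in Ioi 0, κ y * deriv (deriv φ) y := by
  have hφ' := hφ.deriv_of_two
  have d0 : ∀ y, HasDerivAt φ (deriv φ y) y := fun y => (hφ.differentiable two_ne_zero y).hasDerivAt
  have d1 : ∀ y, HasDerivAt (deriv φ) (deriv (deriv φ) y) y := fun y =>
    (hφ'.differentiable one_ne_zero y).hasDerivAt
  have i1 : Integrable fun y => compensatedIncrement φ 0 y * deriv ν y :=
    integrable_compensatedIncrement_mul_deriv hi hφ hc 0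
  have i2 : Integrable fun y => κ y * deriv (deriv φ) y :=
    hκi.integrable_smul_right_of_hasCompactSupport hφ.continuous_deriv_deriv hc.deriv.deriv
  have i3 : Integrable fun y => compensatedIncrement φ 0 y * deriv ν y - κ y * deriv (deriv φ) y :=
    i1.sub i2
  obtain ⟨b, hb⟩ := hc.deriv.deriv.exists_bound_of_continuous hφ.continuous_deriv_deriv
  have hb0 : 0 ≤ b := (norm_nonneg _).trans (hb 0)
  -- the part `0 < y ≤ 1`
  have p1 : ∫ y in (0 : ℝ)..1,
      (compensatedIncrement φ 0 y * deriv ν y - κ y * deriv (deriv φ) y) =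
      ((φ 1 - φ 0 - 1 * deriv φ 0) * ν 1 - (deriv φ 1 - deriv φ 0) * κ 1) - 0 := by
    have hd : ∀ y, 0 < y → HasDerivAt
        (fun y => (φ y - φ 0 - y * deriv φ 0) * ν y - (deriv φ y - deriv φ 0) * κ y)
        ((φ y - φ 0 - y * deriv φ 0) * deriv ν y - κ y * deriv (deriv φ) y) y := fun y hy => by
      have e1 := (((d0 y).sub_const (φ 0)).fun_sub
        ((hasDerivAt_id y).mul_const (deriv φ 0))).fun_mul (hν y hy).hasDerivAt
      have e2 := ((d1 y).sub_const (deriv φ 0)).fun_mul (hκ y hy)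
      refine (e1.fun_sub e2).congr_deriv ?_
      simp only [id]
      ring
    refine intervalIntegral.integral_eq_sub_of_hasDerivAt_of_tendsto (f := fun y =>
      (φ y - φ 0 - y * deriv φ 0) * ν y - (deriv φ y - deriv φ 0) * κ y) zero_lt_one ?_
      i3.intervalIntegrable ?_ ?_
    · intro y hy
      refine (hd y hy.1).congr_deriv ?_
      simp only [compensatedIncrement, zero_add, smul_eq_mul]
      have hy1 : y ∈ Icc (-1 : ℝ) 1 := ⟨by linarith [hy.1], hy.2.le⟩
      rw [indicator_of_mem hy1]
    · have b1 : ∀ y, |(φ y - φ 0 - y * deriv φ 0) * ν y| ≤ b * |y ^ 2 * ν y| := fun y => by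
        have := norm_taylor_one_le hφ hb 0 y
        simp only [zero_add, smul_eq_mul, Real.norm_eq_abs] at this
        rw [abs_mul, abs_mul, ← mul_assoc, abs_of_nonneg (sq_nonneg y)]
        gcongr
      have b2 : ∀ y, |(deriv φ y - deriv φ 0) * κ y| ≤ b * |y * κ y| := fun y => by
        have := convex_univ.norm_image_sub_le_of_norm_deriv_le
          (fun z _ => hφ'.differentiable one_ne_zero z) (fun z _ => hb z) (mem_univ 0) (mem_univ y)
        rw [sub_zero] at this
        rw [abs_mul, abs_mul, ← mul_assoc]
        gcongr
        exact this
      have l1 : Tendsto (fun y => (φ y - φ 0 - y * deriv φ 0) * ν y) (𝓝[>] 0) (𝓝 0) :=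
        squeeze_zero_norm b1 (by simpa using hν0.abs.const_mul b)
      have l2 : Tendsto (fun y => (deriv φ y - deriv φ 0) * κ y) (𝓝[>] 0) (𝓝 0) :=
        squeeze_zero_norm b2 (by simpa using hκ0.abs.const_mul b)
      simpa using l1.sub l2
    · exact (hd 1 one_pos).continuousAt.tendsto.mono_left nhdsWithin_le_nhds
  -- the part `1 < y`
  have p2 : ∫ y in Ioi (1 : ℝ),
      (compensatedIncrement φ 0 y * deriv ν y - κ y * deriv (deriv φ) y) =
      0 - ((φ 1 - φ 0) * ν 1 - deriv φ 1 * κ 1) := by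
    have hd : ∀ y, 0 < y → HasDerivAt (fun y => (φ y - φ 0) * ν y - deriv φ y * κ y)
        ((φ y - φ 0) * deriv ν y - κ y * deriv (deriv φ) y) y := fun y hy => by
      have e1 := ((d0 y).sub_const (φ 0)).fun_mul (hν y hy).hasDerivAt
      have e2 := (d1 y).fun_mul (hκ y hy)
      refine (e1.fun_sub e2).congr_deriv ?_
      ring
    refine integral_Ioi_of_hasDerivAt_of_tendsto (f := fun y =>
      (φ y - φ 0) * ν y - deriv φ y * κ y) (hd 1 one_pos).continuousAt.continuousWithinAt
      (fun y hy => ?_) i3.integrableOn ?_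
    · have hy : 1 < y := hy
      refine (hd y (by linarith)).congr_deriv ?_
      simp only [compensatedIncrement, zero_add]
      rw [indicator_of_notMem fun h : y ∈ Icc (-1 : ℝ) 1 => absurd h.2 (by linarith), sub_zero]
    · have l0 : Tendsto φ atTop (𝓝 0) := hc.is_zero_at_infty.mono_left atTop_le_cocompact
      have l1 := (l0.sub_const (φ 0)).mul hνtop
      have l2 : Tendsto (fun y => deriv φ y * κ y) atTop (𝓝 0) := by
        refine tendsto_const_nhds.congr' ?_
        have : ∀ᶠ y in cocompact ℝ, deriv φ y = 0 := by
          filter_upwards [hc.deriv.compl_mem_cocompact] with y hy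
          exact image_eq_zero_of_notMem_tsupport hy
        filter_upwards [this.filter_mono atTop_le_cocompact] with y hy
        rw [hy, zero_mul]
      simpa using l1.sub l2
  have hsplit : ∫ y in Ioi (0 : ℝ),
      (compensatedIncrement φ 0 y * deriv ν y - κ y * deriv (deriv φ) y) =
      deriv φ 0 * (κ 1 - ν 1) := by
    rw [← intervalIntegral.integral_interval_add_Ioi i3.integrableOn i3.integrableOn, p1, p2]
    ring
  rw [integral_sub i1.integrableOn i2.integrableOn] at hsplit
  linarith

/-- The jump part of the generator as an integral against a primitive `κ` of `ν`, up to a drift. -/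
theorem integral_compensatedIncrement_mul_deriv {ν κ φ : ℝ → ℝ}
    (hν : IsLevyFunction ν) (hκ : ∀ y, y ≠ 0 → HasDerivAt κ (ν y) y)
    (hκi : LocallyIntegrable κ)
    (hκ0 : Tendsto (fun y => y * κ y) (𝓝[≠] 0) (𝓝 0))
    (hν0 : Tendsto (fun y => y ^ 2 * ν y) (𝓝[≠] 0) (𝓝 0))
    (hφ : ContDiff ℝ 2 φ) (hc : HasCompactSupport φ) :
    ∫ y, compensatedIncrement φ 0 y * deriv ν y =
      deriv φ 0 * (κ 1 - ν 1 - κ (-1) - ν (-1)) + ∫ y, κ y * deriv (deriv φ) y := by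
  have hi := hν.levy
  have i1 : Integrable fun y => compensatedIncrement φ 0 y * deriv ν y :=
    integrable_compensatedIncrement_mul_deriv hi hφ hc 0
  have i2 : Integrable fun y => κ y * deriv (deriv φ) y :=
    hκi.integrable_smul_right_of_hasCompactSupport hφ.continuous_deriv_deriv hc.deriv.deriv
  have hle : 𝓝[>] (0 : ℝ) ≤ 𝓝[≠] 0 := nhdsWithin_mono _ fun x hx => ne_of_gt hx
  have hneg : Tendsto (fun y : ℝ => -y) (𝓝[>] 0) (𝓝[≠] 0) := by
    refine tendsto_nhdsWithin_iff.2 ⟨?_, ?_⟩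
    · simpa using (continuous_neg.tendsto (0 : ℝ)).mono_left (nhdsWithin_le_nhds (s := Ioi 0))
    · filter_upwards [self_mem_nhdsWithin] with y hy
      exact neg_ne_zero.2 (ne_of_gt hy)
  have pos := integral_Ioi_compensatedIncrement_mul_deriv (fun y hy => hν.diff y hy.ne')
    (fun y hy => hκ y hy.ne') hi hκi (hκ0.mono_left hle) (hν0.mono_left hle) hν.tendsto_atTop hφ hc
  -- The negative half-line is the positive one for the reflected data.
  have hd : ∀ y, deriv (fun y => -ν (-y)) y = deriv ν (-y) := fun y => by
    rw [deriv.fun_neg, deriv_comp_neg, neg_neg]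
  have hφd : deriv (fun y => φ (-y)) = fun y => -deriv φ (-y) := funext fun y => deriv_comp_neg ..
  have hφdd : ∀ y, deriv (deriv fun y => φ (-y)) y = deriv (deriv φ) (-y) := fun y => by
    rw [hφd, deriv.fun_neg, deriv_comp_neg, neg_neg]
  have hD : ∀ y, compensatedIncrement (fun y => φ (-y)) 0 y = compensatedIncrement φ 0 (-y) := by
    intro y
    simp only [compensatedIncrement, hφd, zero_add, neg_zero]
    by_cases h : y ∈ Icc (-1 : ℝ) 1
    · rw [indicator_of_mem h, indicator_of_mem (by
        rw [mem_Icc]; constructor <;> linarith [h.1, h.2])]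
      simp
    · rw [indicator_of_notMem h, indicator_of_notMem fun h' => h ⟨by linarith [h'.2], by
        linarith [h'.1]⟩]
  have neg := integral_Ioi_compensatedIncrement_mul_deriv (ν := fun y => -ν (-y))
    (κ := fun y => κ (-y)) (φ := fun y => φ (-y))
    (fun y hy => ((differentiableAt_comp_neg).2 (hν.diff (-y) (by linarith))).neg)
    (fun y hy => by
      have := (hκ (-y) (by linarith)).scomp y (hasDerivAt_neg y)
      simpa [Function.comp_def] using this)
    (by
      simp only [hd]
      simpa using hi.comp_neg)
    (locallyIntegrable_comp_neg hκi)
    (by simpa using (hκ0.comp hneg).neg)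
    (by simpa using (hν0.comp hneg).neg)
    (by simpa using (hν.tendsto_atBot.comp tendsto_neg_atTop_atBot).neg)
    (hφ.comp contDiff_neg) (hc.comp_homeomorph (Homeomorph.neg ℝ))
  simp only [hd, hφdd, hD] at neg
  rw [integral_comp_neg_Ioi 0 (fun y => compensatedIncrement φ 0 y * deriv ν y),
    integral_comp_neg_Ioi 0 (fun y => κ y * deriv (deriv φ) y), hφd] at neg
  simp only [neg_zero, sub_neg_eq_add] at neg
  rw [← intervalIntegral.integral_Iic_add_Ioi i1.integrableOn i1.integrableOn,
    ← intervalIntegral.integral_Iic_add_Ioi i2.integrableOn i2.integrableOn, pos, neg]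
  ring

/-! ### The Lévy measure `ν'(x) dx` -/

theorem IsLevyFunction.deriv_nonneg {ν : ℝ → ℝ} (hν : IsLevyFunction ν) {x : ℝ} (hx : x ≠ 0) :
    0 ≤ deriv ν x := by
  rcases hx.lt_or_gt with h | h
  · rw [← derivWithin_of_isOpen isOpen_Iio h]
    exact hν.mono_neg.derivWithin_nonneg
  · rw [← derivWithin_of_isOpen isOpen_Ioi h]
    exact hν.mono_pos.derivWithin_nonneg

theorem IsLevyFunction.toReal_density_ae {ν : ℝ → ℝ} (hν : IsLevyFunction ν) :
    ∀ᵐ x, (ENNReal.ofReal (deriv ν x)).toReal = deriv ν x := by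
  filter_upwards [Measure.ae_ne volume 0] with x hx
  exact ENNReal.toReal_ofReal (hν.deriv_nonneg hx)

theorem IsLevyFunction.integrable_levyMeasure {ν : ℝ → ℝ} (hν : IsLevyFunction ν) :
    Integrable (fun y : ℝ => y ^ 2 / (1 + y ^ 2)) (levyMeasure ν) := by
  unfold levyMeasure
  rw [integrable_withDensity_iff_integrable_smul' (measurable_deriv ν).ennreal_ofReal
    (.of_forall fun x => ENNReal.ofReal_lt_top)]
  refine hν.levy.congr ?_
  filter_upwards [hν.toReal_density_ae] with x hx
  rw [hx, smul_eq_mul, mul_comm]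

theorem IsLevyFunction.integral_levyMeasure {ν : ℝ → ℝ} (hν : IsLevyFunction ν) (g : ℝ → ℝ) :
    ∫ y, g y ∂levyMeasure ν = ∫ y, g y * deriv ν y := by
  unfold levyMeasure
  rw [integral_withDensity_eq_integral_toReal_smul (measurable_deriv ν).ennreal_ofReal
    (.of_forall fun x => ENNReal.ofReal_lt_top)]
  refine integral_congr_ae ?_
  filter_upwards [hν.toReal_density_ae] with x hx
  rw [hx, smul_eq_mul, mul_comm]

/-- The primitive `∫₀ˣ ν` is continuous, so the first set of conditions implies the second. -/
theorem FirstCondition.secondCondition {ν : ℝ → ℝ} (h : FirstCondition ν) : SecondCondition ν where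
  isLevy := h.isLevy
  int_ν M hM := (h.int_ν M hM).continuousOn_mul continuousOn_id isCompact_Icc
  lim_ν := by
    have h1 : Tendsto (fun x : ℝ => x) (𝓝[≠] 0) (𝓝 0) := tendsto_id.mono_left nhdsWithin_le_nhds
    simpa [sq, mul_assoc] using h1.mul h.lim
  prim := by
    have hint : ∀ a b, IntervalIntegrable ν volume a b := fun a b =>
      ((locallyIntegrable_of_integrableOn_Icc_neg h.int_ν).integrableOn_isCompact
        isCompact_uIcc).intervalIntegrable
    have hcont : Continuous fun x => ∫ t in (0 : ℝ)..x, ν t :=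
      intervalIntegral.continuous_primitive hint 0
    refine ⟨fun x => ∫ t in (0 : ℝ)..x, ν t, fun x hx => ?_, fun M _ =>
      hcont.continuousOn.integrableOn_compact isCompact_Icc, ?_⟩
    · refine intervalIntegral.integral_hasDerivAt_right (hint 0 x) ?_
        (h.isLevy.diff x hx).continuousAt
      exact ContinuousOn.stronglyMeasurableAtFilter isOpen_compl_singleton
        (fun y hy => (h.isLevy.diff y hy).continuousAt.continuousWithinAt) x hx
    · have : Continuous fun x : ℝ => x * ∫ t in (0 : ℝ)..x, ν t := by fun_prop
      simpa using (this.tendsto 0).mono_left nhdsWithin_le_nhds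

/-! ### The kernel of the factorization -/

open scoped Convolution in
open ContinuousLinearMap in
theorem hasDerivAt_convOp {k g : ℝ → ℝ} (A : ℝ) (hk : LocallyIntegrable k) (hg : ContDiff ℝ 1 g)
    (hc : HasCompactSupport g) (x : ℝ) :
    HasDerivAt (convOp A k g) (A / 2 * deriv g x + ∫ y, k y * deriv g (x + y)) x := by
  have h1 := hc.hasDerivAt_convolution_left (mul ℝ ℝ) hg (locallyIntegrable_comp_neg hk)
    (μ := volume) x
  have h2 : (g ⋆[mul ℝ ℝ, volume] fun x => k (-x)) = fun x => ∫ y, k (y - x) * g y := by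
    funext x
    simp [convolution_def, mul_comm]
  have h3 : (deriv g ⋆[mul ℝ ℝ, volume] fun x => k (-x)) x = ∫ y, k y * deriv g (x + y) := by
    rw [← integral_sub_right_eq_self (fun y => k y * deriv g (x + y)) x]
    simp [convolution_def, mul_comm]
  rw [h2, h3] at h1
  exact ((hg.differentiable one_ne_zero x).hasDerivAt.const_mul (A / 2)).add h1

theorem integrable_translate_mul {k g : ℝ → ℝ} (hk : LocallyIntegrable k) (hg : Continuous g)
    (hc : HasCompactSupport g) (x : ℝ) : Integrable fun y => k (y - x) * g y := by
  have h1 : Integrable fun y => k y * g (y + x) :=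
    hk.integrable_smul_right_of_hasCompactSupport (g := fun y => g (y + x)) (by fun_prop)
      (hc.comp_homeomorph (Homeomorph.addRight x))
  simpa using h1.comp_sub_right x

theorem theorem2p1 {Ω : Type*} [MeasurableSpace Ω] (P : Measure Ω) [IsProbabilityMeasure P]
    (X : ℝ≥0 → Ω → ℝ) (hX : IsLevyProcess X P) (A γ : ℝ) (hA : 0 ≤ A) (ν : ℝ → ℝ)
    (hν : FirstCondition ν ∨ SecondCondition ν)
    (hXν : HasLevyTriplet X P A γ (levyMeasure ν)) :
    ∃ k : ℝ → ℝ,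
      LocallyIntegrable k ∧
      (∀ x, x ≠ 0 → HasDerivAt k (ν x) x) ∧
      ∀ f : C₀(ℝ, ℝ), ContDiff ℝ 2 f → HasCompactSupport f →
        ∃ Lf : C₀(ℝ, ℝ), IsGeneratorValue X P f Lf ∧
          ∀ x, Integrable (fun y => k (y - x) * deriv f y) ∧
            HasDerivAt (convOp A k (deriv f)) (Lf x) x := by
  have hν2 : SecondCondition ν := hν.elim FirstCondition.secondCondition id
  have hνL := hν2.isLevy
  obtain ⟨κ, hκ, hκM, hκ0⟩ := hν2.prim
  have hκi := locallyIntegrable_of_integrableOn_Icc_neg hκM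
  have hN := hνL.integrable_levyMeasure
  have : SFinite (levyMeasure ν) := by unfold levyMeasure; infer_instance
  -- The jump `C` of `k - κ` at `0` absorbs `γ` and the drift left by the integration by parts.
  obtain ⟨C, hC⟩ : ∃ C, C = -(γ + (κ 1 - ν 1 - κ (-1) - ν (-1))) := ⟨_, rfl⟩
  have hind : LocallyIntegrable ((Ioi (0 : ℝ)).indicator fun _ => C) :=
    (locallyIntegrable_const C).indicator measurableSet_Ioi
  have hk : LocallyIntegrable fun x => κ x + (Ioi (0 : ℝ)).indicator (fun _ => C) x := hκi.add hind
  refine ⟨_, hk, fun x hx => ?_, fun f hf hc => ?_⟩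
  · have h1 : HasDerivAt ((Ioi (0 : ℝ)).indicator fun _ => C) 0 x := by
      rcases hx.lt_or_gt with h | h
      · refine (hasDerivAt_const x (0 : ℝ)).congr_of_eventuallyEq ?_
        filter_upwards [Iio_mem_nhds h] with y hy
        exact indicator_of_notMem (fun h' => lt_asymm h' hy) _
      · refine (hasDerivAt_const x C).congr_of_eventuallyEq ?_
        filter_upwards [Ioi_mem_nhds h] with y hy
        exact indicator_of_mem (show y ∈ Ioi (0 : ℝ) from hy) _
    simpa using (hκ x hx).fun_add h1
  · refine ⟨_, isGeneratorValue_levyOperator hX.measurable hN hXν f hf hc, fun x =>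
      ⟨integrable_translate_mul hk hf.deriv_of_two.continuous hc.deriv x, ?_⟩⟩
    refine (hasDerivAt_convOp A hk hf.deriv_of_two hc.deriv x).congr_deriv ?_
    change _ = levyOperator A γ (levyMeasure ν) f x
    have hs : ContDiff ℝ 2 fun y => f (x + y) := hf.comp (contDiff_const.add contDiff_id)
    have hsc : HasCompactSupport fun y => f (x + y) := hc.comp_homeomorph (Homeomorph.addLeft x)
    have d1 : (deriv fun y => f (x + y)) = fun y => deriv f (x + y) :=
      funext fun y => deriv_comp_const_add ..
    have d2 : (deriv fun y => deriv f (x + y)) = fun y => deriv (deriv f) (x + y) :=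
      funext fun y => deriv_comp_const_add ..
    have h1 := integral_compensatedIncrement_mul_deriv hνL hκ hκi hκ0 hν2.lim_ν hs hsc
    have h2 : ∀ y, compensatedIncrement (fun y => f (x + y)) 0 y = compensatedIncrement f x y := by
      intro y
      simp only [compensatedIncrement, d1, zero_add, add_zero]
    rw [d1, d2] at h1
    simp only [h2, add_zero] at h1
    have h3 : ∫ y in Ioi (0 : ℝ), deriv (deriv f) (x + y) = -deriv f x := by
      have h4 : ContDiff ℝ 1 fun y => deriv f (x + y) := d1 ▸ hs.deriv_of_two
      have h5 : HasCompactSupport fun y => deriv f (x + y) := d1 ▸ hsc.deriv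
      have := h5.integral_Ioi_deriv_eq h4 0
      rwa [d2, add_zero] at this
    have i1 : Integrable fun y => κ y * deriv (deriv f) (x + y) :=
      hκi.integrable_smul_right_of_hasCompactSupport
        (d2 ▸ d1 ▸ hs.continuous_deriv_deriv) (d2 ▸ d1 ▸ hsc.deriv.deriv)
    have i2 : Integrable fun y =>
        (Ioi (0 : ℝ)).indicator (fun _ => C) y * deriv (deriv f) (x + y) :=
      hind.integrable_smul_right_of_hasCompactSupport
        (d2 ▸ d1 ▸ hs.continuous_deriv_deriv) (d2 ▸ d1 ▸ hsc.deriv.deriv)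
    have h4 : ∫ y, (Ioi (0 : ℝ)).indicator (fun _ => C) y * deriv (deriv f) (x + y) =
        C * -deriv f x := by
      rw [← h3, ← integral_const_mul, ← integral_indicator measurableSet_Ioi]
      refine integral_congr_ae (.of_forall fun y => ?_)
      simp only [indicator_apply]
      split_ifs <;> simp
    simp only [add_mul]
    unfold levyOperator
    rw [integral_add i1 i2, h4, hνL.integral_levyMeasure, h1, hC]
    ring
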